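/- **Setting.** Let $(Y,h)$ be the thrice-punctured sphere $Y=S^2\setminus\{c_1,c_2,c_3\}$ with its complete finite-area hyperbolic metric of curvature $-1$ (unique up to isometry; concretely $Y=\Gamma(2)\backslash\mathbb H$ with the metric induced by $(dx^2+dy^2)/y^2$). Write $S^1=\mathbb R/\mathbb Z$. The cusps of $Y$ are, in horocyclic coordinates about $c_i$, $$C_i=(-\infty,\log 2]\times S^1,\qquad h|_{C_i}=d\rho^2+e^{2\rho}\,d\theta^2 ,$$ and have pairwise disjoint interiors (if $c_i$ corresponds to $\sigma_i\infty$ with $\sigma_i\in SL_2(\mathbb Z)$, then $(\rho,\theta)$ is the class of $\sigma_i(2\theta+2e^{-\rho}\sqrt{-1})$). Put $C_i^{\le\sigma}=C_i\cap\{\rho\le\sigma\}$. Let $\rho_*<\log 2$ and let $f_*:(-\infty,\log 2]\to(0,\infty)$ be a smooth function with $f_*=1$ on $[\rho_*,\log 2]$ and $f_*(\rho)=e^\rho/(2\pi)$ for $\rho\le\rho_*-1$. Let $h_*$ be the metric on $Y$ that equals $h$ outside the cusps and $f_*(\rho)^2\,d\rho^2+e^{2\rho}\,d\theta^2$ on each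 $C_i$. With $r=e^\rho/(2\pi)$ and angle $2\pi\theta$ as polar coordinates about $c_i$, the metric $h_*$ is flat near $c_i$ and extends smoothly across $c_1,c_2,c_3$; $(S^2,h_*)$ denotes the resulting closed Riemannian surface, the metric completion of $(Y,h_*)$. Closed geodesics are nonconstant, and $\operatorname{sys}$ denotes the systolic length, i.e. the infimum of the lengths of all closed geodesics. **Theorem 4.1.** Suppose $\rho_*<\log 2-\operatorname{sys}(Y,h)$. Then a closed curve $\gamma$ in $S^2$ is a closed geodesic of $(S^2,h_*)$ of length $\operatorname{sys}(S^2,h_*)$ if and only if it is contained in the region $Y\setminus\bigcup_{i=1}^3C_i^{\le\rho_*}$, where $h_*=h$, and is a closed geodesic of $(Y,h)$ of length $\operatorname{sys}(Y,h)$. -/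

import Mathlib

open scoped ContDiff MatrixGroups Matrix Topology ENNReal

noncomputable section

/-! ### Riemannian surfaces described by local parametrizations -/

/-- A parametrization `toFun : dom → X` of part of a surface `X` by an open set `dom` of the
coordinate plane, with the coefficients `metric p = (g_ij(p))` of a Riemannian metric in these
coordinates. A surface with a Riemannian metric is given by a set of such patches whose images
cover it and which are local isometries onto their images (they need not be injective: a covering
by the upper half-plane is allowed). -/
structure Patch (X : Type*) where
  dom : Set (Fin 2 → ℝ)
  toFun : (Fin 2 → ℝ) → X
  metric : (Fin 2 → ℝ) → Matrix (Fin 2) (Fin 2) ℝ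

namespace Patch

variable {X : Type*}

/-- The partial derivative `∂_k g_ij` at `p`. -/
def dMetric (P : Patch X) (p : Fin 2 → ℝ) (k i j : Fin 2) : ℝ :=
  fderiv ℝ (fun q => P.metric q i j) p (Pi.single k 1)

/-- The Christoffel symbol
`Γ^k_ij = (1/2) ∑_l g^{kl} (∂_i g_jl + ∂_j g_il - ∂_l g_ij)` at `p`. -/
def christoffel (P : Patch X) (p : Fin 2 → ℝ) (k i j : Fin 2) : ℝ :=
  (1 / 2) * ∑ l, (P.metric p)⁻¹ k l * (P.dMetric p i j l + P.dMetric p j i l - P.dMetric p l i j)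

/-- The length `√(g_ij(p) v^i v^j)` of the coordinate vector `v` at `p`. -/
def vecLength (P : Patch X) (p v : Fin 2 → ℝ) : ℝ :=
  Real.sqrt (∑ i, ∑ j, P.metric p i j * v i * v j)

/-- `c` expresses the curve `γ` in the coordinates of `P` at all times near `t`. -/
def IsLift (P : Patch X) (c : ℝ → Fin 2 → ℝ) (γ : ℝ → X) (t : ℝ) : Prop :=
  ContDiffAt ℝ 2 c t ∧ ∀ᶠ s in 𝓝 t, c s ∈ P.dom ∧ γ s = P.toFun (c s)

/-- The geodesic equation `(c^k)'' + Γ^k_ij(c) (c^i)' (c^j)' = 0` at time `s`. -/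
def GeodesicEq (P : Patch X) (c : ℝ → Fin 2 → ℝ) (s : ℝ) : Prop :=
  ∀ k, deriv (deriv c) s k + ∑ i, ∑ j, P.christoffel (c s) k i j * deriv c s i * deriv c s j = 0

end Patch

section Geodesics

variable {X : Type*}

/-- A geodesic: near every time the curve satisfies the geodesic equation in some patch. -/
def IsGeodesic (A : Set (Patch X)) (γ : ℝ → X) : Prop :=
  ∀ t, ∃ P ∈ A, ∃ c, P.IsLift c γ t ∧ ∀ᶠ s in 𝓝 t, P.GeodesicEq c s

/-- A closed geodesic with period `T`: a nonconstant `T`-periodic geodesic. -/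
def IsClosedGeodesic (A : Set (Patch X)) (γ : ℝ → X) (T : ℝ) : Prop :=
  0 < T ∧ Function.Periodic γ T ∧ IsGeodesic A γ ∧ ∃ s t, γ s ≠ γ t

/-- The speed of the curve `γ` at time `t`, computed in any local coordinate expression. For patches
that are local isometries all the expressions give the same value, which is therefore the
infimum; it is `⊤` if `γ` is not a `C²` curve near `t`. -/
def curveSpeed (A : Set (Patch X)) (γ : ℝ → X) (t : ℝ) : ℝ≥0∞ :=
  ⨅ (P : Patch X) (_ : P ∈ A) (c : ℝ → Fin 2 → ℝ) (_ : P.IsLift c γ t),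
    ENNReal.ofReal (P.vecLength (c t) (deriv c t))

/-- The length of one period of a closed curve. -/
def closedLength (A : Set (Patch X)) (γ : ℝ → X) (T : ℝ) : ℝ≥0∞ :=
  ∫⁻ t in Set.Ioc 0 T, curveSpeed A γ t

/-- The systolic length: the infimum of the lengths of all closed geodesics. -/
def systole (A : Set (Patch X)) : ℝ≥0∞ :=
  ⨅ (γ : ℝ → X) (T : ℝ) (_ : IsClosedGeodesic A γ T), closedLength A γ T

end Geodesics

/-! ### The thrice-punctured sphere, its cusps, and the sphere -/

/-- The thrice-punctured sphere `Y = Γ(2)\ℍ`. The group `Γ(2)/{±1}` acts freely on `ℍ` and the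
hyperbolic metric of `ℍ` descends to the complete finite-area metric `h` of curvature `-1`. -/
abbrev PuncturedSphere : Type :=
  MulAction.orbitRel.Quotient (CongruenceSubgroup.Gamma 2) UpperHalfPlane

/-- The sphere `S² = Y ∪ {c_0, c_1, c_2}`, obtained from the thrice-punctured sphere by filling in
the punctures. -/
abbrev Sphere3 : Type := PuncturedSphere ⊕ Fin 3

/-- The subset `Y = S² \ {c_0, c_1, c_2}` of the sphere. -/
def puncturedPart : Set Sphere3 := Set.range Sum.inl

/-- The quotient map `ℍ → Y ⊆ S²`. -/
def proj (z : UpperHalfPlane) : Sphere3 := Sum.inl (Quotient.mk _ z)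

/-- Elements of `SL(2, ℤ)` that send `∞` to representatives `∞`, `0`, `1` of the three cusps
of `Γ(2)`. -/
def cuspElt : Fin 3 → SL(2, ℤ) :=
  ![1, ModularGroup.S, ModularGroup.T * ModularGroup.S]

/-- Horocyclic coordinates `(ρ, θ)` about the puncture `c_i`, with `θ` in `ℝ/ℤ`: the point of `Y`
represented by `σ_i (x + i y)` with `x = 2 θ` and `y = 2 exp (-ρ)`. As the cusp `∞` of `Γ(2)` has
the stabilizer generated by `z ↦ z + 2` (and `-1`), this is `1`-periodic in `θ`, and the hyperbolic
metric `(dx² + dy²)/y²` becomes `dρ² + exp (2ρ) dθ²`. -/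
def cuspMap (i : Fin 3) (ρ θ : ℝ) : Sphere3 :=
  proj (cuspElt i • (⟨⟨2 * θ, 2 * Real.exp (-ρ)⟩, by positivity⟩ : UpperHalfPlane))

/-- The `σ`-thin part `C_i ∩ {ρ ≤ σ}` of the cusp `C_i = (-∞, log 2] × ℝ/ℤ`. -/
def thinCusp (i : Fin 3) (σ : ℝ) : Set Sphere3 :=
  {q | ∃ ρ θ : ℝ, ρ ≤ Real.log 2 ∧ ρ ≤ σ ∧ q = cuspMap i ρ θ}

/-- The complement in `Y` of the `σ`-thin parts of the three cusps. -/
def thickPart (σ : ℝ) : Set Sphere3 := puncturedPart \ ⋃ i, thinCusp i σ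

/-! ### The hyperbolic metric `h` -/

/-- The upper half-plane with the hyperbolic metric `(dx² + dy²)/y²` and its quotient map to `Y`. -/
def hypPatch : Patch Sphere3 where
  dom := {p | 0 < p 1}
  toFun p := proj (UpperHalfPlane.ofComplex ⟨p 0, p 1⟩)
  metric p := Matrix.diagonal ![1 / p 1 ^ 2, 1 / p 1 ^ 2]

/-- The hyperbolic surface `(Y, h)`, where `Y` is regarded as a subset of the sphere. -/
def hypSurface : Set (Patch Sphere3) := {hypPatch}

/-! ### The truncated and capped metric `h_*` -/

/-- The profiles `f_* : (-∞, log 2] → (0, ∞)` used to truncate at `ρ_*`: smooth functions that equal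
`1` on `[ρ_*, log 2]` and `exp ρ / (2π)` for `ρ ≤ ρ_* - 1`. With `θ` in `ℝ/ℤ`, so that the angle is
`2πθ`, the latter makes `f_*² dρ² + exp (2ρ) dθ²` the flat metric `dr² + r² d(2πθ)²`, where
`r = exp ρ / (2π)`. -/
structure IsCapProfile (ρs : ℝ) (f : ℝ → ℝ) : Prop where
  smooth : ContDiffOn ℝ ∞ f (Set.Iic (Real.log 2))
  pos : ∀ ρ ≤ Real.log 2, 0 < f ρ
  eq_one : ∀ ρ ∈ Set.Icc ρs (Real.log 2), f ρ = 1
  eq_exp : ∀ ρ ≤ ρs - 1, f ρ = Real.exp ρ / (2 * Real.pi)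

/-- The part of `Y` outside the `ρ_*`-thin cusps, with the hyperbolic metric. -/
def thickPatch (ρs : ℝ) : Patch Sphere3 where
  dom := {p | p ∈ hypPatch.dom ∧ hypPatch.toFun p ∈ thickPart ρs}
  toFun := hypPatch.toFun
  metric := hypPatch.metric

/-- The interior of the cusp `C_i`, with the metric `f(ρ)² dρ² + exp (2ρ) dθ²`. -/
def cuspPatch (f : ℝ → ℝ) (i : Fin 3) : Patch Sphere3 where
  dom := {p | p 0 < Real.log 2}
  toFun p := cuspMap i (p 0) (p 1)
  metric p := Matrix.diagonal ![f (p 0) ^ 2, Real.exp (2 * p 0)]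

/-- The flat disc about `c_i` of radius `exp (ρ_* - 1) / (2π)`: its centre is sent to `c_i`, and the
point with polar coordinates `r > 0` and angle `2πθ` to the point with horocyclic coordinates
`(log (2πr), θ)`. -/
def flatPatch (ρs : ℝ) (i : Fin 3) : Patch Sphere3 where
  dom := {p | ‖(⟨p 0, p 1⟩ : ℂ)‖ < Real.exp (ρs - 1) / (2 * Real.pi)}
  toFun p :=
    if p = 0 then Sum.inr i
    else cuspMap i (Real.log (2 * Real.pi * ‖(⟨p 0, p 1⟩ : ℂ)‖))
      (Complex.arg ⟨p 0, p 1⟩ / (2 * Real.pi))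
  metric _ := 1

/-- The closed surface `(S², h_*)`. -/
def cappedSurface (ρs : ℝ) (f : ℝ → ℝ) : Set (Patch Sphere3) :=
  {thickPatch ρs} ∪ Set.range (cuspPatch f) ∪ Set.range (flatPatch ρs)

end

/-! The argument compares both metrics through one function on the sphere, `radius`, which is `exp
ρ` in the cusps, at least `2` exactly outside their interiors, and `0` at the punctures. It comes
from the maximal imaginary part in an `SL(2, ℤ)`-orbit, so all three cusps are treated at once, and
the thick part is the superlevel set `radius > exp ρ_*` (`mem_thickPart_iff`).

Two facts hold for `h` and `h_*` alike. First, no closed geodesic stays where `radius < 2`. There a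
function is strictly convex along moving geodesics: `radius` itself for `h`, the squared distance to
the puncture for `h_*`. A periodic convex function is constant, so such a curve would be stationary
(`not_isClosedGeodesic_of_convexAlong`). Second, on the collar `ρ_* < ρ < log 2` the profile is `1`,
and `log radius = ρ` changes no faster than arc length.

Hence a closed geodesic of either metric that leaves the thick part crosses a whole collar within
one period and has length at least `log 2 - ρ_*` (`log_two_sub_le_closedLength`), which exceeds the
hyperbolic systole. On curves in the thick part the metrics agree, as do geodesics and lengths. So
the systoles agree (`systole_cappedSurface`), and systolic geodesics of `h_*` stay in the thick
part. -/

noncomputable section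

/-! ### The height of a point of the thrice-punctured sphere in the cusps -/

section Height

open UpperHalfPlane

/-- The imaginary part of `g • z` is `y / |cz + d|²`. If `c = 0` then `d = ±1` and it is `y`;
otherwise `|cz + d|² ≥ c²y² ≥ y²` and it is at most `1/y`. -/
theorem im_smul_le_max (g : SL(2, ℤ)) (z : ℍ) : (g • z).im ≤ max z.im z.im⁻¹ := by
  have hy := z.im_pos
  have hd := g.det_coe
  rw [Matrix.det_fin_two] at hd
  rw [ModularGroup.im_smul_eq_div_normSq, ModularGroup.denom_apply]
  have hN : Complex.normSq ((g 1 0 : ℂ) * z + g 1 1)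
      = (g 1 0 * z.re + g 1 1) ^ 2 + (g 1 0 : ℝ) ^ 2 * z.im ^ 2 := by
    rw [Complex.normSq_apply]; simp; ring
  rw [hN]
  by_cases hc : g 1 0 = 0
  · have h1 : (g 1 1 : ℝ) ^ 2 = 1 := by
      rw [hc, mul_zero, sub_zero] at hd
      have : g 1 1 = 1 ∨ g 1 1 = -1 := by
        rcases Int.mul_eq_one_iff_eq_one_or_neg_one.mp hd with h | h <;> simp [h]
      rcases this with h | h <;> simp [h]
    simp [hc, h1]
  · have h1 : (1 : ℝ) ≤ (g 1 0 : ℝ) ^ 2 := by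
      have : (1 : ℤ) ≤ (g 1 0) ^ 2 := by have := sq_pos_of_ne_zero hc; lia
      exact_mod_cast this
    refine le_max_of_le_right ?_
    rw [div_le_iff₀ (by positivity), ← div_eq_inv_mul, le_div_iff₀ hy]
    nlinarith [sq_nonneg (g 1 0 * z.re + g 1 1 : ℝ), mul_le_mul_of_nonneg_right h1 (sq_nonneg z.im)]

/-- The logarithm of the maximal imaginary part in the `SL(2, ℤ)`-orbit of `z`. -/
def logHeight (z : ℍ) : ℝ := ⨆ g : SL(2, ℤ), Real.log (g • z).im

theorem bddAbove_log_im_smul (z : ℍ) :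
    BddAbove (Set.range fun g : SL(2, ℤ) => Real.log (g • z).im) := by
  refine ⟨Real.log (max z.im z.im⁻¹), ?_⟩
  rintro _ ⟨g, rfl⟩
  exact Real.log_le_log (im_pos _) (im_smul_le_max g z)

theorem logHeight_smul (g : SL(2, ℤ)) (z : ℍ) : logHeight (g • z) = logHeight z := by
  unfold logHeight
  rw [← (Equiv.mulRight g).iSup_comp (g := fun g' : SL(2, ℤ) => Real.log (g' • z).im)]
  simp [mul_smul]

/-- `log Im` is 1-Lipschitz for the hyperbolic distance and `SL(2, ℤ)` acts by isometries, so the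
supremum is 1-Lipschitz too. This yields continuity of the height. -/
theorem logHeight_le_add_dist (z w : ℍ) : logHeight z ≤ logHeight w + dist z w := by
  refine ciSup_le fun g => ?_
  have h1 : dist (Real.log (g • z).im) (Real.log (g • w).im) ≤ dist z w := by
    refine (UpperHalfPlane.dist_log_im_le _ _).trans_eq ?_
    exact dist_smul (g : SL(2, ℝ)) z w
  have h2 := le_ciSup (bddAbove_log_im_smul w) g
  rw [Real.dist_eq] at h1
  have := le_abs_self (Real.log (g • z).im - Real.log (g • w).im)
  unfold logHeight
  linarith

theorem continuous_logHeight : Continuous logHeight := by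
  refine LipschitzWith.continuous (K := 1) (LipschitzWith.of_dist_le_mul fun z w => ?_)
  rw [Real.dist_eq, abs_le, NNReal.coe_one, one_mul]
  have := logHeight_le_add_dist z w
  have := logHeight_le_add_dist w z
  rw [dist_comm w z] at this
  constructor <;> linarith

theorem logHeight_of_one_le_im {z : ℍ} (hz : 1 ≤ z.im) : logHeight z = Real.log z.im := by
  refine le_antisymm (ciSup_le fun g => ?_) ?_
  · refine Real.log_le_log (im_pos _) ((im_smul_le_max g z).trans_eq ?_)
    exact max_eq_left ((inv_le_one_of_one_le₀ hz).trans hz)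
  · have h := le_ciSup (bddAbove_log_im_smul z) 1
    rwa [one_smul] at h

theorem exists_one_lt_im_smul {z : ℍ} (hz : 0 < logHeight z) : ∃ g : SL(2, ℤ), 1 < (g • z).im := by
  obtain ⟨g, hg⟩ := exists_lt_of_lt_ciSup hz
  exact ⟨g, (Real.log_pos_iff (im_pos _).le).1 hg⟩

/-- The function on the sphere that equals `exp ρ` in the cusps with horocyclic coordinates
`(ρ, θ)`, and `0` at the punctures. -/
def radius : Sphere3 → ℝ :=
  Sum.elim (Quotient.lift (fun z : ℍ => 2 * Real.exp (-logHeight z)) (by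
    rintro z w ⟨g, rfl⟩
    simp only [Subgroup.smul_def, logHeight_smul])) fun _ => 0

theorem radius_proj (z : ℍ) : radius (proj z) = 2 * Real.exp (-logHeight z) := rfl

theorem radius_inr (i : Fin 3) : radius (Sum.inr i) = 0 := rfl

theorem continuous_radius_proj : Continuous fun z : ℍ => radius (proj z) := by
  simp only [radius_proj]
  exact continuous_const.mul (Real.continuous_exp.comp continuous_logHeight.neg)

theorem radius_proj_smul (g : SL(2, ℤ)) (z : ℍ) : radius (proj (g • z)) = radius (proj z) := by
  rw [radius_proj, radius_proj, logHeight_smul]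

theorem radius_proj_of_one_le_im {z : ℍ} (hz : 1 ≤ z.im) : radius (proj z) = 2 / z.im := by
  rw [radius_proj, logHeight_of_one_le_im hz, Real.exp_neg, Real.exp_log z.im_pos, div_eq_mul_inv]

theorem radius_cuspMap (i : Fin 3) {ρ : ℝ} (hρ : ρ ≤ Real.log 2) (θ : ℝ) :
    radius (cuspMap i ρ θ) = Real.exp ρ := by
  have h : Real.exp ρ ≤ 2 := by
    rwa [Real.le_log_iff_exp_le two_pos] at hρ
  rw [cuspMap, radius_proj_smul, radius_proj_of_one_le_im]
  · simp only [mk_im, Real.exp_neg]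
    field_simp
  · simp only [mk_im, Real.exp_neg, ← div_eq_mul_inv]
    rw [one_le_div (Real.exp_pos _)]
    exact h

theorem exists_one_lt_im_smul_of_radius_lt {z : ℍ} (hz : radius (proj z) < 2) :
    ∃ g : SL(2, ℤ), 1 < (g • z).im := by
  refine exists_one_lt_im_smul ?_
  rw [radius_proj] at hz
  by_contra! h
  have := Real.one_le_exp (neg_nonneg.2 h)
  linarith

theorem proj_smul_of_mem_Gamma {g : SL(2, ℤ)} (hg : g ∈ CongruenceSubgroup.Gamma 2) (z : ℍ) :
    proj (g • z) = proj z :=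
  congrArg Sum.inl (Quotient.sound ⟨⟨g, hg⟩, rfl⟩)

/-- Modulo `2` the products `σ_i T^n` with `n ∈ {0, 1}` exhaust the six elements of `SL(2, ℤ/2)`, so
one of them inverts `g`. This is why three cusps suffice. -/
theorem exists_cuspElt_mul_T_pow_mul_mem_Gamma (g : SL(2, ℤ)) :
    ∃ (i : Fin 3) (n : ℤ), cuspElt i * ModularGroup.T ^ n * g ∈ CongruenceSubgroup.Gamma 2 := by
  -- A finite check over the matrices with entries in `ℤ/2`.
  have key : ∀ h : Matrix (Fin 2) (Fin 2) (ZMod 2), h.det = 1 → ∃ (i : Fin 3) (n : Fin 2),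
      ((cuspElt i : Matrix (Fin 2) (Fin 2) ℤ).map (Int.castRingHom (ZMod 2))) *
        (!![1, (n : ℤ); 0, 1] : Matrix (Fin 2) (Fin 2) ℤ).map (Int.castRingHom (ZMod 2)) * h =
          1 := by
    decide +kernel
  obtain ⟨i, n, h⟩ := key ((g : Matrix (Fin 2) (Fin 2) ℤ).map (Int.castRingHom (ZMod 2))) (by
    rw [← RingHom.mapMatrix_apply, ← RingHom.map_det, g.det_coe, map_one])
  refine ⟨i, (n : ℕ), ?_⟩
  rw [CongruenceSubgroup.Gamma_mem']
  ext1
  rw [← Matrix.map_mul, ← Matrix.map_mul] at h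
  rw [← ModularGroup.coe_T_zpow, ← Matrix.SpecialLinearGroup.coe_mul,
    ← Matrix.SpecialLinearGroup.coe_mul] at h
  rw [Matrix.SpecialLinearGroup.map_apply_coe, RingHom.mapMatrix_apply, h]
  rfl

/-- The power of `T` from the coset decomposition only shifts the real part, hence `θ`; the
imaginary part of `g • z` alone determines `ρ`. -/
theorem exists_proj_eq_cuspMap (g : SL(2, ℤ)) (z : ℍ) :
    ∃ i θ, proj z = cuspMap i (Real.log (2 / (g • z).im)) θ := by
  obtain ⟨i, n, h⟩ := exists_cuspElt_mul_T_pow_mul_mem_Gamma g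
  refine ⟨i, (ModularGroup.T ^ n • g • z).re / 2, ?_⟩
  rw [← proj_smul_of_mem_Gamma h, mul_smul, mul_smul, cuspMap]
  congr 2
  have := (g • z).im_pos
  refine ext_re_im ?_ ?_
  · simp only [mk_re]; ring
  · rw [ModularGroup.im_T_zpow_smul]
    simp only [mk_im]
    rw [Real.exp_neg, Real.exp_log (by positivity)]
    field_simp

/-- Since `exp σ < 2`, a point of `Y` with `radius ≤ exp σ` has a translate of imaginary part above
`1`, where `radius` is `2 / Im`; that translate gives horocyclic coordinates with `ρ ≤ σ`. -/
theorem mem_thickPart_iff {σ : ℝ} (hσ : σ < Real.log 2) (q : Sphere3) :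
    q ∈ thickPart σ ↔ Real.exp σ < radius q := by
  have h2 : Real.exp σ < 2 := by rwa [Real.lt_log_iff_exp_lt two_pos] at hσ
  constructor
  · rintro ⟨⟨x, rfl⟩, hq⟩
    obtain ⟨z, rfl⟩ := Quotient.exists_rep x
    change proj z ∉ _ at hq
    change _ < radius (proj z)
    by_contra! hle
    obtain ⟨g, hg⟩ := exists_one_lt_im_smul_of_radius_lt (hle.trans_lt h2)
    obtain ⟨i, θ, h⟩ := exists_proj_eq_cuspMap g z
    rw [← radius_proj_smul g, radius_proj_of_one_le_im hg.le] at hle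
    have hρ : Real.log (2 / (g • z).im) ≤ σ :=
      (Real.log_le_iff_le_exp (div_pos two_pos (im_pos _))).2 hle
    exact hq (Set.mem_iUnion.2 ⟨i, _, θ, hρ.trans hσ.le, hρ, h⟩)
  · intro hq
    refine ⟨?_, fun h => ?_⟩
    · rcases q with x | i
      · exact ⟨x, rfl⟩
      · rw [radius_inr] at hq
        exact absurd hq (Real.exp_pos σ).le.not_gt
    · obtain ⟨i, ρ, θ, hρ, hρσ, rfl⟩ := Set.mem_iUnion.1 h
      rw [radius_cuspMap i hρ, Real.exp_lt_exp] at hq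
      exact hq.not_ge hρσ

end Height

end

noncomputable section

/-! ### Curves of class `C²` -/

section Regularity

variable {E : Type*} [NormedAddCommGroup E] [NormedSpace ℝ E]

theorem ContDiffAt.eventually_hasDerivAt_two {c : ℝ → E} {t : ℝ} (hc : ContDiffAt ℝ 2 c t) :
    ∀ᶠ s in 𝓝 t, ContDiffAt ℝ 2 c s ∧ HasDerivAt c (deriv c s) s ∧
      HasDerivAt (deriv c) (deriv (deriv c) s) s := by
  filter_upwards [hc.eventually (by simp)] with s hs
  refine ⟨hs, (hs.differentiableAt (by norm_num)).hasDerivAt, ?_⟩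
  have h : ContDiffAt ℝ 1 (fun u => fderiv ℝ c u 1) s :=
    (hs.fderiv_right (m := 1) (by norm_num)).clm_apply contDiffAt_const
  exact (h.differentiableAt one_ne_zero).hasDerivAt

/-- The formula for `deriv c` must hold on a neighbourhood before it can be differentiated again;
hence the eventual form used throughout. -/
theorem eventually_deriv_eq_of_hasDerivAt {c c1 c2 : ℝ → E} {t : ℝ}
    (h : ∀ᶠ s in 𝓝 t, HasDerivAt c (c1 s) s ∧ HasDerivAt c1 (c2 s) s) :
    ∀ᶠ s in 𝓝 t, deriv c s = c1 s ∧ deriv (deriv c) s = c2 s := by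
  filter_upwards [h.eventually_nhds] with s hs
  have h1 : deriv c =ᶠ[𝓝 s] c1 := hs.mono fun u hu => hu.1.deriv
  exact ⟨h1.eq_of_nhds, by rw [h1.deriv_eq, hs.self_of_nhds.2.deriv]⟩

end Regularity

/-- The plane curve `c`, as a curve in `ℂ`. -/
def toComplexCurve (c : ℝ → Fin 2 → ℝ) (s : ℝ) : ℂ := ⟨c s 0, c s 1⟩

theorem toComplexCurve_eq (c : ℝ → Fin 2 → ℝ) :
    toComplexCurve c = fun s => (c s 0 : ℂ) + c s 1 * Complex.I := by
  ext s
  exact Complex.mk_eq_add_mul_I _ _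

theorem contDiffAt_toComplexCurve {c : ℝ → Fin 2 → ℝ} {t : ℝ} {n : WithTop ℕ∞}
    (hc : ContDiffAt ℝ n c t) : ContDiffAt ℝ n (toComplexCurve c) t := by
  rw [toComplexCurve_eq]
  have h := contDiffAt_pi.1 hc
  have h' : ∀ k, ContDiffAt ℝ n (fun s => (c s k : ℂ)) t := fun k =>
    Complex.ofRealCLM.contDiff.contDiffAt.comp t (h k)
  exact (h' 0).add ((h' 1).mul contDiffAt_const)

theorem hasDerivAt_toComplexCurve {c : ℝ → Fin 2 → ℝ} {c' : Fin 2 → ℝ} {s : ℝ}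
    (hc : HasDerivAt c c' s) : HasDerivAt (toComplexCurve c) ⟨c' 0, c' 1⟩ s := by
  rw [toComplexCurve_eq, Complex.mk_eq_add_mul_I]
  have h := hasDerivAt_pi.1 hc
  exact ((h 0).ofReal_comp).add (((h 1).ofReal_comp).mul_const _)

theorem eventually_deriv_toComplexCurve {c : ℝ → Fin 2 → ℝ} {t : ℝ} (hc : ContDiffAt ℝ 2 c t) :
    ∀ᶠ s in 𝓝 t, deriv (toComplexCurve c) s = ⟨deriv c s 0, deriv c s 1⟩ ∧
      deriv (deriv (toComplexCurve c)) s = ⟨deriv (deriv c) s 0, deriv (deriv c) s 1⟩ :=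
  eventually_deriv_eq_of_hasDerivAt (hc.eventually_hasDerivAt_two.mono fun _ hs =>
    ⟨hasDerivAt_toComplexCurve hs.2.1, hasDerivAt_toComplexCurve hs.2.2⟩)

/-! ### Geodesics of diagonal metrics -/

theorem fderiv_comp_apply_single {φ : ℝ → ℝ} {φ' : ℝ} {p : Fin 2 → ℝ} {k : Fin 2}
    (h : HasDerivAt φ φ' (p k)) (j : Fin 2) :
    fderiv ℝ (fun q : Fin 2 → ℝ => φ (q k)) p (Pi.single j 1) = if k = j then φ' else 0 := by
  have h1 : HasFDerivAt (fun q : Fin 2 → ℝ => q k)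
      (ContinuousLinearMap.proj (R := ℝ) (φ := fun _ : Fin 2 => ℝ) k) p :=
    (ContinuousLinearMap.proj (R := ℝ) (φ := fun _ : Fin 2 => ℝ) k).hasFDerivAt
  have h2 : HasFDerivAt (fun q : Fin 2 → ℝ => φ (q k)) _ p := h.comp_hasFDerivAt p h1
  rw [h2.fderiv]
  simp [Pi.single_apply]

/-- Multiplying the two equations by `2E` and `2G` clears the inverse metric from the Christoffel
symbols. -/
theorem Patch.geodesicEq_iff_of_diagonal {X : Type*} {P : Patch X} {E G : (Fin 2 → ℝ) → ℝ}
    (hP : P.metric = fun q => Matrix.diagonal ![E q, G q]) (c : ℝ → Fin 2 → ℝ) (s : ℝ)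
    (hE : E (c s) ≠ 0) (hG : G (c s) ≠ 0) {E0 E1 G0 G1 : ℝ}
    (hE0 : fderiv ℝ E (c s) (Pi.single 0 1) = E0) (hE1 : fderiv ℝ E (c s) (Pi.single 1 1) = E1)
    (hG0 : fderiv ℝ G (c s) (Pi.single 0 1) = G0) (hG1 : fderiv ℝ G (c s) (Pi.single 1 1) = G1) :
    P.GeodesicEq c s ↔
      2 * E (c s) * deriv (deriv c) s 0 + E0 * deriv c s 0 ^ 2
        + 2 * E1 * deriv c s 0 * deriv c s 1 - G0 * deriv c s 1 ^ 2 = 0 ∧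
      2 * G (c s) * deriv (deriv c) s 1 - E1 * deriv c s 0 ^ 2
        + 2 * G0 * deriv c s 0 * deriv c s 1 + G1 * deriv c s 1 ^ 2 = 0 := by
  have hinv : (P.metric (c s))⁻¹ = Matrix.diagonal ![(E (c s))⁻¹, (G (c s))⁻¹] := by
    refine Matrix.inv_eq_right_inv ?_
    rw [hP, Matrix.diagonal_mul_diagonal, ← Matrix.diagonal_one]
    congr 1
    ext i
    fin_cases i <;> simp [hE, hG]
  have h00 : ∀ k, P.dMetric (c s) k 0 0 = fderiv ℝ E (c s) (Pi.single k 1) := fun k => by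
    simp [Patch.dMetric, hP]
  have h11 : ∀ k, P.dMetric (c s) k 1 1 = fderiv ℝ G (c s) (Pi.single k 1) := fun k => by
    simp [Patch.dMetric, hP]
  have h01 : ∀ k, P.dMetric (c s) k 0 1 = 0 := fun k => by
    simp [Patch.dMetric, hP]
  have h10 : ∀ k, P.dMetric (c s) k 1 0 = 0 := fun k => by
    simp [Patch.dMetric, hP]
  simp only [Patch.GeodesicEq, Patch.christoffel, hinv, Fin.forall_fin_two, Fin.sum_univ_two,
    h00, h11, h01, h10, hE0, hE1, hG0, hG1, Matrix.diagonal_apply, Matrix.cons_val_zero,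
    Matrix.cons_val_one]
  simp only [Fin.isValue, ↓reduceIte, zero_ne_one, one_ne_zero]
  refine and_congr ?_ ?_
  · rw [← mul_right_inj' (mul_ne_zero two_ne_zero hE), mul_zero]
    refine Eq.congr ?_ rfl
    field_simp
    ring
  · rw [← mul_right_inj' (mul_ne_zero two_ne_zero hG), mul_zero]
    refine Eq.congr ?_ rfl
    field_simp
    ring

theorem Patch.vecLength_of_diagonal {X : Type*} {P : Patch X} {p : Fin 2 → ℝ} {e g : ℝ}
    (hP : P.metric p = Matrix.diagonal ![e, g]) (v : Fin 2 → ℝ) :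
    P.vecLength p v = Real.sqrt (e * v 0 ^ 2 + g * v 1 ^ 2) := by
  simp only [Patch.vecLength, hP, Fin.sum_univ_two, Matrix.diagonal_apply]
  simp
  ring_nf

/-! ### The geodesic equation of the hyperbolic plane -/

/-- The geodesic equation of the upper half-plane in complex notation. -/
def HypGeodesicEq (w : ℝ → ℂ) (s : ℝ) : Prop :=
  deriv (deriv w) s * (w s).im = -Complex.I * deriv w s ^ 2

theorem hypPatch_geodesicEq_iff {c : ℝ → Fin 2 → ℝ} {s : ℝ} (hs : 0 < c s 1) :
    hypPatch.GeodesicEq c s ↔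
      deriv (deriv c) s 0 * c s 1 = 2 * deriv c s 0 * deriv c s 1 ∧
      deriv (deriv c) s 1 * c s 1 = deriv c s 1 ^ 2 - deriv c s 0 ^ 2 := by
  have hd : HasDerivAt (fun y : ℝ => 1 / y ^ 2) (-2 / c s 1 ^ 3) (c s 1) := by
    have := (hasDerivAt_pow 2 (c s 1)).inv (by positivity)
    simp only [one_div]
    refine this.congr_deriv ?_
    field_simp
    norm_num
    ring
  rw [Patch.geodesicEq_iff_of_diagonal (P := hypPatch) (E := fun q => 1 / q 1 ^ 2)
    (G := fun q => 1 / q 1 ^ 2) rfl c s (by positivity) (by positivity)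
    (fderiv_comp_apply_single hd 0) (fderiv_comp_apply_single hd 1)
    (fderiv_comp_apply_single hd 0) (fderiv_comp_apply_single hd 1)]
  simp only [Fin.isValue, ↓reduceIte, one_ne_zero]
  refine and_congr ?_ ?_
  · rw [← mul_right_inj' (pow_ne_zero 3 hs.ne'), mul_zero]
    field_simp
    exact ⟨fun h => by linear_combination h / 2, fun h => by linear_combination 2 * h⟩
  · rw [← mul_right_inj' (pow_ne_zero 3 hs.ne'), mul_zero]
    field_simp
    exact ⟨fun h => by linear_combination h / 2, fun h => by linear_combination 2 * h⟩

theorem eventually_hypPatch_geodesicEq_iff {c : ℝ → Fin 2 → ℝ} {t : ℝ} (hc : ContDiffAt ℝ 2 c t) :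
    ∀ᶠ s in 𝓝 t, 0 < c s 1 →
      (hypPatch.GeodesicEq c s ↔ HypGeodesicEq (toComplexCurve c) s) := by
  filter_upwards [eventually_deriv_toComplexCurve hc] with s hs hpos
  rw [hypPatch_geodesicEq_iff hpos, HypGeodesicEq, hs.1, hs.2, Complex.ext_iff]
  simp only [toComplexCurve, pow_two, Complex.mul_re, Complex.mul_im, Complex.neg_re,
    Complex.neg_im, Complex.I_re, Complex.I_im, Complex.ofReal_re, Complex.ofReal_im]
  refine and_congr ?_ ?_
  · constructor <;> intro h <;> linear_combination h
  · constructor <;> intro h <;> linear_combination h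

theorem hypPatch_vecLength {c : ℝ → Fin 2 → ℝ} {t : ℝ} (hc : ContDiffAt ℝ 2 c t)
    (hpos : 0 < c t 1) :
    hypPatch.vecLength (c t) (deriv c t) =
      ‖deriv (toComplexCurve c) t‖ / (toComplexCurve c t).im := by
  rw [Patch.vecLength_of_diagonal (P := hypPatch) rfl,
    (eventually_deriv_toComplexCurve hc).self_of_nhds.1, Complex.norm_def, Complex.normSq_mk]
  simp only [toComplexCurve]
  rw [eq_div_iff hpos.ne', ← Real.sqrt_sq hpos.le, ← Real.sqrt_mul (by positivity),
    Real.sqrt_sq hpos.le]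
  congr 1
  field_simp

end

/-! ### Curves in the upper half-plane under Möbius transformations -/

noncomputable section

/-- With `D = cz + d`, the transformed curve has `w' = z'/D²` and `Im w = Im z / |D|²`, so the
hyperbolic speed is preserved. In complex form the invariance of the geodesic equation is a single
algebraic identity. -/
theorem exists_smul_curve {z : ℝ → ℂ} {t : ℝ} (hz : ContDiffAt ℝ 2 z t) (hpos : 0 < (z t).im)
    (g : SL(2, ℤ)) :
    ∃ w : ℝ → ℂ, ContDiffAt ℝ 2 w t ∧ ∀ᶠ s in 𝓝 t, 0 < (z s).im ∧ 0 < (w s).im ∧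
      UpperHalfPlane.ofComplex (w s) = g • UpperHalfPlane.ofComplex (z s) ∧
      ‖deriv w s‖ / (w s).im = ‖deriv z s‖ / (z s).im ∧
      (HypGeodesicEq z s → HypGeodesicEq w s) := by
  have hdet := g.det_coe
  rw [Matrix.det_fin_two] at hdet
  obtain ⟨a, ha⟩ : ∃ a : ℤ, a = g 0 0 := ⟨_, rfl⟩
  obtain ⟨b, hb⟩ : ∃ b : ℤ, b = g 0 1 := ⟨_, rfl⟩
  obtain ⟨c, hc⟩ : ∃ c : ℤ, c = g 1 0 := ⟨_, rfl⟩
  obtain ⟨d, hd⟩ : ∃ d : ℤ, d = g 1 1 := ⟨_, rfl⟩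
  have hdetR : (a : ℝ) * d - b * c = 1 := by rw [ha, hb, hc, hd]; exact_mod_cast hdet
  have hdetC : (a : ℂ) * d - b * c = 1 := by exact_mod_cast hdetR
  have hden : ∀ τ : ℂ, 0 < τ.im → (c : ℂ) * τ + d ≠ 0 := by
    intro τ hτ h
    have him := congrArg Complex.im h
    have hre := congrArg Complex.re h
    simp at him hre
    rcases him with h0 | h0
    · rw [h0] at hre hdetR
      simp at hre
      rw [hre] at hdetR
      simp at hdetR
    · exact hτ.ne' h0
  have hpos' : ∀ᶠ s in 𝓝 t, 0 < (z s).im :=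
    (Complex.continuous_im.continuousAt.comp hz.continuousAt).eventually (lt_mem_nhds hpos)
  have hder : ∀ᶠ s in 𝓝 t,
      HasDerivAt (fun s => (a * z s + b) / (c * z s + d)) (deriv z s / (c * z s + d) ^ 2) s ∧
      HasDerivAt (fun s => deriv z s / (c * z s + d) ^ 2)
        (deriv (deriv z) s / (c * z s + d) ^ 2 - 2 * c * deriv z s ^ 2 / (c * z s + d) ^ 3) s := by
    filter_upwards [hz.eventually_hasDerivAt_two, hpos'] with s ⟨_, h1, h2⟩ hp
    have hne := hden _ hp
    have hD : HasDerivAt (fun s => (c : ℂ) * z s + d) (c * deriv z s) s :=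
      (h1.const_mul _).add_const _
    have hN : HasDerivAt (fun s => (a : ℂ) * z s + b) (a * deriv z s) s :=
      (h1.const_mul _).add_const _
    refine ⟨(hN.div hD hne).congr_deriv ?_, (h2.div (hD.pow 2) (pow_ne_zero 2 hne)).congr_deriv ?_⟩
    · field_simp
      linear_combination (deriv z s) * hdetC
    · simp only [Pi.pow_apply]
      field_simp
      push_cast
      ring
  refine ⟨fun s => (a * z s + b) / (c * z s + d), ?_, ?_⟩
  · simp only [div_eq_mul_inv]
    exact ((contDiffAt_const.mul hz).add contDiffAt_const).mul
      (((contDiffAt_const.mul hz).add contDiffAt_const).inv (hden _ hpos))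
  · filter_upwards [hpos', eventually_deriv_eq_of_hasDerivAt hder] with s hp ⟨hw1, hw2⟩
    have hne := hden _ hp
    have hw : (a * z s + b) / (c * z s + d) =
        ((g • UpperHalfPlane.ofComplex (z s) : UpperHalfPlane) : ℂ) := by
      rw [UpperHalfPlane.coe_specialLinearGroup_apply, UpperHalfPlane.ofComplex_apply_of_im_pos hp,
        ha, hb, hc, hd]
      simp
    have him : ((a * z s + b) / (c * z s + d)).im = (z s).im / Complex.normSq (c * z s + d) := by
      rw [hw, UpperHalfPlane.coe_im, ModularGroup.im_smul_eq_div_normSq, ModularGroup.denom_apply,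
        UpperHalfPlane.ofComplex_apply_of_im_pos hp, hc, hd]
      simp
    have hn : 0 < Complex.normSq (c * z s + d) := Complex.normSq_pos.2 hne
    refine ⟨hp, ?_, ?_, ?_, fun h => ?_⟩
    · rw [him]; positivity
    · rw [hw, UpperHalfPlane.ofComplex_apply]
    · rw [him, hw1, norm_div, norm_pow, Complex.normSq_eq_norm_sq]
      have := norm_pos_iff.2 hne
      field_simp
    · unfold HypGeodesicEq at h ⊢
      rw [hw2, hw1, him]
      have hy : ((z s).im : ℂ) ≠ 0 := by exact_mod_cast hp.ne'
      -- As `c` and `d` are real, the conjugate of `D = cz + d` is `D - 2ic Im z`; this turns `|D|²`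
      -- into a polynomial expression.
      have hN : (Complex.normSq (c * z s + d) : ℂ) =
          (c * z s + d) * (c * z s + d - 2 * c * (z s).im * Complex.I) := by
        rw [← Complex.mul_conj]
        congr 1
        apply Complex.ext <;> simp
        ring
      have hne' : (c * z s + d - 2 * c * (z s).im * Complex.I) ≠ 0 := by
        have : (Complex.normSq (c * z s + d) : ℂ) ≠ 0 := by exact_mod_cast hn.ne'
        rw [hN] at this
        exact right_ne_zero_of_mul this
      rw [Complex.ofReal_div, hN]
      generalize hM : c * z s + d - 2 * c * (z s).im * Complex.I = M at hne' ⊢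
      generalize c * z s + d = D at hne hM ⊢
      field_simp
      rw [← hM]
      linear_combination D * h - 2 * c * (z s).im * deriv z s ^ 2 * Complex.I_sq

/-! ### Lifts in the three kinds of patches -/

theorem hypPatch_toFun {c : ℝ → Fin 2 → ℝ} (s : ℝ) :
    hypPatch.toFun (c s) = proj (UpperHalfPlane.ofComplex (toComplexCurve c s)) := rfl

/-- The curve in the upper half-plane with horocyclic coordinates `c` about the cusp `∞`. -/
def horocyclicCurve (c : ℝ → Fin 2 → ℝ) (s : ℝ) : ℂ := ⟨2 * c s 1, 2 * Real.exp (-c s 0)⟩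

theorem horocyclicCurve_im_pos (c : ℝ → Fin 2 → ℝ) (s : ℝ) : 0 < (horocyclicCurve c s).im := by
  simp only [horocyclicCurve]; positivity

theorem cuspMap_eq_proj_smul (c : ℝ → Fin 2 → ℝ) (s : ℝ) (i : Fin 3) :
    cuspMap i (c s 0) (c s 1) =
      proj (cuspElt i • UpperHalfPlane.ofComplex (horocyclicCurve c s)) := by
  rw [UpperHalfPlane.ofComplex_apply_of_im_pos (horocyclicCurve_im_pos c s)]
  rfl

theorem horocyclicCurve_eq (c : ℝ → Fin 2 → ℝ) :
    horocyclicCurve c = toComplexCurve fun s => ![2 * c s 1, 2 * Real.exp (-c s 0)] := by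
  ext s
  simp [horocyclicCurve, toComplexCurve]

theorem contDiffAt_horocyclicCurve {c : ℝ → Fin 2 → ℝ} {t : ℝ} (hc : ContDiffAt ℝ 2 c t) :
    ContDiffAt ℝ 2 (horocyclicCurve c) t := by
  rw [horocyclicCurve_eq]
  have h := contDiffAt_pi.1 hc
  refine contDiffAt_toComplexCurve (contDiffAt_pi.2 fun k => ?_)
  fin_cases k
  · exact contDiffAt_const.mul (h 1)
  · exact contDiffAt_const.mul (Real.contDiff_exp.contDiffAt.comp t (h 0).neg)

theorem eventually_deriv_horocyclicCurve {c : ℝ → Fin 2 → ℝ} {t : ℝ} (hc : ContDiffAt ℝ 2 c t) :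
    ∀ᶠ s in 𝓝 t,
      deriv (horocyclicCurve c) s =
        ⟨2 * deriv c s 1, -2 * deriv c s 0 * Real.exp (-c s 0)⟩ ∧
      deriv (deriv (horocyclicCurve c)) s =
        ⟨2 * deriv (deriv c) s 1,
          (2 * deriv c s 0 ^ 2 - 2 * deriv (deriv c) s 0) * Real.exp (-c s 0)⟩ := by
  have key : ∀ᶠ s in 𝓝 t,
      HasDerivAt (fun s => (![2 * c s 1, 2 * Real.exp (-c s 0)] : Fin 2 → ℝ))
        ![2 * deriv c s 1, -2 * deriv c s 0 * Real.exp (-c s 0)] s ∧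
      HasDerivAt (fun s => (![2 * deriv c s 1, -2 * deriv c s 0 * Real.exp (-c s 0)] : Fin 2 → ℝ))
        ![2 * deriv (deriv c) s 1,
          (2 * deriv c s 0 ^ 2 - 2 * deriv (deriv c) s 0) * Real.exp (-c s 0)] s := by
    filter_upwards [hc.eventually_hasDerivAt_two] with s ⟨_, h1, h2⟩
    have h1 := hasDerivAt_pi.1 h1
    have h2 := hasDerivAt_pi.1 h2
    have he := (h1 0).neg.exp
    refine ⟨hasDerivAt_pi.2 fun k => ?_, hasDerivAt_pi.2 fun k => ?_⟩ <;> fin_cases k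
    · exact (h1 1).const_mul 2
    · exact (he.const_mul 2).congr_deriv (by simp; ring)
    · exact (h2 1).const_mul 2
    · exact (((h2 0).const_mul (-2)).mul he).congr_deriv (by simp; ring)
  rw [horocyclicCurve_eq]
  have h := eventually_deriv_eq_of_hasDerivAt (key.mono fun s hs =>
    And.intro (hasDerivAt_toComplexCurve hs.1) (hasDerivAt_toComplexCurve hs.2))
  exact h.mono fun s hs => by simpa using hs

/-- The left side of the first equation is `f (f ρ')'`, the form needed for differentiating the
distance to the puncture; the second is Clairaut's relation `(exp (2ρ) θ')' = 0`. -/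
theorem cuspPatch_geodesicEq_iff {f : ℝ → ℝ} {f' : ℝ} (i : Fin 3) {c : ℝ → Fin 2 → ℝ} {s : ℝ}
    (hf : HasDerivAt f f' (c s 0)) (hpos : 0 < f (c s 0)) :
    (cuspPatch f i).GeodesicEq c s ↔
      f (c s 0) ^ 2 * deriv (deriv c) s 0 + f (c s 0) * f' * deriv c s 0 ^ 2
        = Real.exp (2 * c s 0) * deriv c s 1 ^ 2 ∧
      deriv (deriv c) s 1 = -2 * deriv c s 0 * deriv c s 1 := by
  have hE : HasDerivAt (fun x => f x ^ 2) (2 * f (c s 0) * f') (c s 0) := by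
    simpa using hf.fun_pow 2
  have hG : HasDerivAt (fun x : ℝ => Real.exp (2 * x)) (2 * Real.exp (2 * c s 0)) (c s 0) :=
    (((hasDerivAt_id (c s 0)).const_mul 2).exp).congr_deriv (by simp; ring)
  have he := Real.exp_pos (2 * c s 0)
  rw [Patch.geodesicEq_iff_of_diagonal (P := cuspPatch f i) (E := fun q => f (q 0) ^ 2)
    (G := fun q => Real.exp (2 * q 0)) rfl c s (by positivity) (by positivity)
    (fderiv_comp_apply_single hE 0) (fderiv_comp_apply_single hE 1)
    (fderiv_comp_apply_single hG 0) (fderiv_comp_apply_single hG 1)]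
  simp only [Fin.isValue, ↓reduceIte, zero_ne_one]
  refine and_congr ?_ ?_
  · exact ⟨fun h => by linear_combination h / 2, fun h => by linear_combination 2 * h⟩
  · refine ⟨fun h => mul_left_cancel₀ he.ne' ?_, fun h => ?_⟩
    · linear_combination h / 2
    · linear_combination 2 * Real.exp (2 * c s 0) * h

theorem eventually_hypGeodesicEq_horocyclicCurve {f : ℝ → ℝ} {c : ℝ → Fin 2 → ℝ} {t : ℝ}
    (hc : ContDiffAt ℝ 2 c t) (i : Fin 3) :
    ∀ᶠ s in 𝓝 t, f =ᶠ[𝓝 (c s 0)] 1 → (cuspPatch f i).GeodesicEq c s →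
      HypGeodesicEq (horocyclicCurve c) s := by
  filter_upwards [eventually_deriv_horocyclicCurve hc] with s ⟨h1, h2⟩ hf hgeo
  have hfs : f (c s 0) = 1 := hf.eq_of_nhds
  have hd : HasDerivAt f 0 (c s 0) := (hasDerivAt_const (c s 0) (1 : ℝ)).congr_of_eventuallyEq hf
  rw [cuspPatch_geodesicEq_iff i hd (by rw [hfs]; exact one_pos), hfs] at hgeo
  have hexp : Real.exp (2 * c s 0) * Real.exp (-c s 0) ^ 2 = 1 := by
    rw [← Real.exp_nat_mul, ← Real.exp_add]
    simp
  rw [HypGeodesicEq, h1, h2, Complex.ext_iff]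
  simp only [horocyclicCurve, pow_two, Complex.mul_re, Complex.mul_im, Complex.neg_re,
    Complex.neg_im, Complex.I_re, Complex.I_im, Complex.ofReal_re, Complex.ofReal_im]
  constructor
  · rw [hgeo.2]; ring
  · linear_combination (-4 * Real.exp (-c s 0) ^ 2) * hgeo.1 - 4 * deriv c s 1 ^ 2 * hexp

theorem cuspPatch_vecLength {f : ℝ → ℝ} {c : ℝ → Fin 2 → ℝ} {t : ℝ} (hc : ContDiffAt ℝ 2 c t)
    (i : Fin 3) (hf : f (c t 0) = 1) :
    (cuspPatch f i).vecLength (c t) (deriv c t) =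
      ‖deriv (horocyclicCurve c) t‖ / (horocyclicCurve c t).im := by
  rw [Patch.vecLength_of_diagonal (P := cuspPatch f i) rfl,
    (eventually_deriv_horocyclicCurve hc).self_of_nhds.1, Complex.norm_def, Complex.normSq_mk]
  have hexp : Real.exp (2 * c t 0) * Real.exp (-c t 0) ^ 2 = 1 := by
    rw [← Real.exp_nat_mul, ← Real.exp_add]
    simp
  have hpos : 0 < 2 * Real.exp (-c t 0) := by positivity
  simp only [horocyclicCurve]
  rw [eq_div_iff hpos.ne', ← Real.sqrt_sq hpos.le, ← Real.sqrt_mul (by positivity), hf]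
  congr 1
  linear_combination 4 * deriv c t 1 ^ 2 * hexp

/-- The lift to the upper half-plane of a curve given in horocyclic coordinates where the profile
is `1`. -/
theorem exists_hypPatch_isLift_of_cuspPatch {f : ℝ → ℝ} {i : Fin 3} {c : ℝ → Fin 2 → ℝ}
    {γ : ℝ → Sphere3} {t : ℝ} (hc : (cuspPatch f i).IsLift c γ t)
    (hf : ∀ᶠ s in 𝓝 t, f =ᶠ[𝓝 (c s 0)] 1) :
    ∃ c', hypPatch.IsLift c' γ t ∧
      hypPatch.vecLength (c' t) (deriv c' t) = (cuspPatch f i).vecLength (c t) (deriv c t) ∧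
      ((∀ᶠ s in 𝓝 t, (cuspPatch f i).GeodesicEq c s) →
        ∀ᶠ s in 𝓝 t, hypPatch.GeodesicEq c' s) := by
  obtain ⟨hc2, hcγ⟩ := hc
  obtain ⟨w, hw, h⟩ := exists_smul_curve (contDiffAt_horocyclicCurve hc2)
    (horocyclicCurve_im_pos c t) (cuspElt i)
  set c' : ℝ → Fin 2 → ℝ := fun s => ![(w s).re, (w s).im] with hc'
  have hc'w : toComplexCurve c' = w := by ext s; simp [toComplexCurve, hc']
  have hc'2 : ContDiffAt ℝ 2 c' t := by
    refine contDiffAt_pi.2 fun k => ?_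
    fin_cases k
    · exact Complex.reCLM.contDiff.contDiffAt.comp t hw
    · exact Complex.imCLM.contDiff.contDiffAt.comp t hw
  refine ⟨c', ⟨hc'2, ?_⟩, ?_, fun hgeo => ?_⟩
  · filter_upwards [h, hcγ] with s hs hγs
    refine ⟨hs.2.1, ?_⟩
    rw [hγs.2, hypPatch_toFun, hc'w, hs.2.2.1]
    exact cuspMap_eq_proj_smul c s i
  · have ht := h.self_of_nhds
    rw [hypPatch_vecLength hc'2 ht.2.1, hc'w, ht.2.2.2.1,
      cuspPatch_vecLength hc2 i hf.self_of_nhds.eq_of_nhds]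
  · filter_upwards [h, hgeo, hf, eventually_hypPatch_geodesicEq_iff hc'2,
      eventually_hypGeodesicEq_horocyclicCurve (f := f) hc2 i] with s hs hgs hfs hiff himp
    rw [hiff hs.2.1, hc'w]
    exact hs.2.2.2.2 (himp hfs hgs)

/-- A curve in the upper half-plane whose image in a cusp is expressed by a curve in the horoball
about `∞`. -/
theorem exists_curve_of_hypPatch_isLift {c : ℝ → Fin 2 → ℝ} {γ : ℝ → Sphere3} {t : ℝ}
    (hc : hypPatch.IsLift c γ t) (hγ : radius (γ t) < 2) :
    ∃ w : ℝ → ℂ, ContDiffAt ℝ 2 w t ∧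
      hypPatch.vecLength (c t) (deriv c t) = ‖deriv w t‖ / (w t).im ∧
      (∀ᶠ s in 𝓝 t, 1 < (w s).im ∧ radius (γ s) = 2 / (w s).im ∧ (deriv w s = 0 → deriv c s = 0)) ∧
      ((∀ᶠ s in 𝓝 t, hypPatch.GeodesicEq c s) → ∀ᶠ s in 𝓝 t, HypGeodesicEq w s) := by
  obtain ⟨hc2, hcγ⟩ := hc
  have hpos := hcγ.self_of_nhds.1
  have hγt := hcγ.self_of_nhds.2
  rw [hypPatch_toFun] at hγt
  rw [hγt] at hγ
  obtain ⟨g, hg⟩ := exists_one_lt_im_smul_of_radius_lt hγ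
  obtain ⟨w, hw, h⟩ := exists_smul_curve (contDiffAt_toComplexCurve hc2) hpos g
  have him : ∀ s, 0 < (w s).im → (UpperHalfPlane.ofComplex (w s)).im = (w s).im := fun s hs => by
    rw [UpperHalfPlane.ofComplex_apply_of_im_pos hs, UpperHalfPlane.mk_im]
  have hwt : 1 < (w t).im := by
    have ht := h.self_of_nhds
    rwa [← ht.2.2.1, him t ht.2.1] at hg
  refine ⟨w, hw, ?_, ?_, fun hgeo => ?_⟩
  · rw [hypPatch_vecLength hc2 hpos, h.self_of_nhds.2.2.2.1]
  · filter_upwards [h, hcγ, (Complex.continuous_im.continuousAt.comp hw.continuousAt).eventually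
      (lt_mem_nhds hwt), eventually_deriv_toComplexCurve hc2] with s hs hγs hws hds
    refine ⟨hws, ?_, fun h0 => ?_⟩
    · rw [hγs.2, hypPatch_toFun, ← radius_proj_smul g, ← hs.2.2.1, radius_proj_of_one_le_im,
        him s hs.2.1]
      rw [him s hs.2.1]
      exact hws.le
    -- Equal hyperbolic speeds: `w` is stationary only where `c` is.
    · have h1 := hs.2.2.2.1
      rw [h0, norm_zero, zero_div, eq_comm, div_eq_zero_iff, or_iff_left hs.1.ne', norm_eq_zero,
        hds.1, Complex.ext_iff] at h1
      ext k
      fin_cases k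
      · exact h1.1
      · exact h1.2
  · filter_upwards [h, hgeo, eventually_hypPatch_geodesicEq_iff hc2] with s hs hgs hiff
    exact hs.2.2.2.2 ((hiff hs.1).1 hgs)

end

noncomputable section

/-! ### The radius in the patches -/

section Patches

variable {ρs : ℝ} {f : ℝ → ℝ} {γ : ℝ → Sphere3} {c : ℝ → Fin 2 → ℝ} {t : ℝ} {i : Fin 3}

theorem two_pi_mul_norm_lt {p : Fin 2 → ℝ} (hp : p ∈ (flatPatch ρs i).dom) :
    2 * Real.pi * ‖(⟨p 0, p 1⟩ : ℂ)‖ < Real.exp (ρs - 1) := by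
  have hp' : ‖(⟨p 0, p 1⟩ : ℂ)‖ < Real.exp (ρs - 1) / (2 * Real.pi) := hp
  rwa [lt_div_iff₀ (by positivity), mul_comm] at hp'

theorem radius_flatPatch (hρs : ρs < Real.log 2) {p : Fin 2 → ℝ} (hp : p ∈ (flatPatch ρs i).dom) :
    radius ((flatPatch ρs i).toFun p) = 2 * Real.pi * ‖(⟨p 0, p 1⟩ : ℂ)‖ := by
  have h := two_pi_mul_norm_lt hp
  by_cases h0 : p = 0
  · subst h0
    have : (⟨0, 0⟩ : ℂ) = 0 := rfl
    simp [flatPatch, radius_inr, this]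
  · have hne : (⟨p 0, p 1⟩ : ℂ) ≠ 0 := fun hz => h0 (by
      have h1 := congrArg Complex.re hz
      have h2 := congrArg Complex.im hz
      ext k
      fin_cases k
      · exact h1
      · exact h2)
    have hpos : 0 < 2 * Real.pi * ‖(⟨p 0, p 1⟩ : ℂ)‖ := by
      have := norm_pos_iff.2 hne
      positivity
    have hlog : Real.log (2 * Real.pi * ‖(⟨p 0, p 1⟩ : ℂ)‖) < ρs - 1 :=
      (Real.log_lt_iff_lt_exp hpos).2 h
    simp only [flatPatch, if_neg h0]
    rw [radius_cuspMap i (by linarith), Real.exp_log hpos]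

theorem continuousAt_radius_of_hypPatch (hc : hypPatch.IsLift c γ t) :
    ContinuousAt (fun s => radius (γ s)) t := by
  have hpos : 0 < (toComplexCurve c t).im := hc.2.self_of_nhds.1
  have h1 : ContinuousAt (fun s => UpperHalfPlane.ofComplex (toComplexCurve c s)) t :=
    (UpperHalfPlane.contMDiffAt_ofComplex (n := 0) hpos).continuousAt.comp
      (f := toComplexCurve c) (x := t) (contDiffAt_toComplexCurve hc.1).continuousAt
  have h2 := continuous_radius_proj.continuousAt.comp h1
  refine h2.congr (hc.2.mono fun s hs => ?_)
  simp only [hs.2]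
  rfl

theorem eventually_radius_eq_of_cuspPatch (hc : (cuspPatch f i).IsLift c γ t) :
    ∀ᶠ s in 𝓝 t, c s 0 < Real.log 2 ∧ radius (γ s) = Real.exp (c s 0) := by
  filter_upwards [hc.2] with s hs
  have h1 : c s 0 < Real.log 2 := hs.1
  rw [hs.2]
  exact ⟨h1, radius_cuspMap i h1.le _⟩

theorem eventually_radius_eq_of_flatPatch (hρs : ρs < Real.log 2)
    (hc : (flatPatch ρs i).IsLift c γ t) :
    ∀ᶠ s in 𝓝 t, radius (γ s) < Real.exp (ρs - 1) ∧
      radius (γ s) = 2 * Real.pi * ‖toComplexCurve c s‖ := by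
  filter_upwards [hc.2] with s hs
  rw [hs.2, radius_flatPatch hρs hs.1]
  exact ⟨two_pi_mul_norm_lt hs.1, rfl⟩

theorem thickPatch_isLift_iff :
    (thickPatch ρs).IsLift c γ t ↔ hypPatch.IsLift c γ t ∧ ∀ᶠ s in 𝓝 t, γ s ∈ thickPart ρs := by
  constructor
  · rintro ⟨h1, h2⟩
    exact ⟨⟨h1, h2.mono fun s hs => ⟨hs.1.1, hs.2⟩⟩, h2.mono fun s hs => hs.2 ▸ hs.1.2⟩
  · rintro ⟨⟨h1, h2⟩, h3⟩
    exact ⟨h1, (h2.and h3).mono fun s hs => ⟨⟨hs.1.1, hs.1.2 ▸ hs.2⟩, hs.1.2⟩⟩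

theorem continuousAt_radius_of_mem_cappedSurface (hρs : ρs < Real.log 2) {P : Patch Sphere3}
    (hP : P ∈ cappedSurface ρs f) (hc : P.IsLift c γ t) :
    ContinuousAt (fun s => radius (γ s)) t := by
  rcases hP with (rfl | ⟨i, rfl⟩) | ⟨i, rfl⟩
  · exact continuousAt_radius_of_hypPatch (thickPatch_isLift_iff.1 hc).1
  · refine ContinuousAt.congr (f := fun s => Real.exp (c s 0)) ?_
      ((eventually_radius_eq_of_cuspPatch hc).mono fun s hs => hs.2.symm)
    exact ((contDiffAt_pi.1 hc.1 0).continuousAt).rexp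
  · refine ContinuousAt.congr (f := fun s => 2 * Real.pi * ‖toComplexCurve c s‖) ?_
      ((eventually_radius_eq_of_flatPatch hρs hc).mono fun s hs => hs.2.symm)
    exact continuousAt_const.mul (contDiffAt_toComplexCurve hc.1).continuousAt.norm

theorem IsCapProfile.eventuallyEq_one (hf : IsCapProfile ρs f) {ρ : ℝ} (h1 : ρs < ρ)
    (h2 : ρ < Real.log 2) : f =ᶠ[𝓝 ρ] 1 := by
  filter_upwards [Ioo_mem_nhds h1 h2] with x hx
  exact hf.eq_one x ⟨hx.1.le, hx.2.le⟩

theorem eventually_eventuallyEq_one_of_cuspPatch (hf : IsCapProfile ρs f)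
    (hc : (cuspPatch f i).IsLift c γ t) (hγ : ∀ᶠ s in 𝓝 t, Real.exp ρs < radius (γ s)) :
    ∀ᶠ s in 𝓝 t, f =ᶠ[𝓝 (c s 0)] 1 := by
  filter_upwards [eventually_radius_eq_of_cuspPatch hc, hγ] with s hs hγs
  rw [hs.2, Real.exp_lt_exp] at hγs
  exact hf.eventuallyEq_one hγs hs.1

/-! ### Comparison of the two metrics on the thick part -/

/-- On such a curve `radius > exp ρ_*`: flat discs, where `radius < exp (ρ_* - 1)`, are never met,
and cusp coordinates see only `f = 1` on a neighbourhood, so the derivative of `f` vanishes as well.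
-/
theorem isGeodesic_cappedSurface_iff (hf : IsCapProfile ρs f) (hρs : ρs < Real.log 2)
    (hγ : Set.range γ ⊆ thickPart ρs) :
    IsGeodesic (cappedSurface ρs f) γ ↔ IsGeodesic hypSurface γ := by
  have hrad : ∀ s, Real.exp ρs < radius (γ s) := fun s =>
    (mem_thickPart_iff hρs _).1 (hγ ⟨s, rfl⟩)
  constructor
  · intro h t
    obtain ⟨P, hP, c, hc, hgeo⟩ := h t
    refine ⟨hypPatch, rfl, ?_⟩
    rcases hP with (rfl | ⟨i, rfl⟩) | ⟨i, rfl⟩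
    · exact ⟨c, (thickPatch_isLift_iff.1 hc).1, hgeo⟩
    · obtain ⟨c', hc', -, hgeo'⟩ := exists_hypPatch_isLift_of_cuspPatch hc
        (eventually_eventuallyEq_one_of_cuspPatch hf hc (.of_forall hrad))
      exact ⟨c', hc', hgeo' hgeo⟩
    · have h1 := (eventually_radius_eq_of_flatPatch hρs hc).self_of_nhds.1
      have h2 := (hrad t).trans h1
      rw [Real.exp_lt_exp] at h2
      linarith
  · intro h t
    obtain ⟨P, rfl, c, hc, hgeo⟩ := h t
    exact ⟨thickPatch ρs, Or.inl (Or.inl rfl), c,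
      thickPatch_isLift_iff.2 ⟨hc, .of_forall fun s => hγ ⟨s, rfl⟩⟩, hgeo⟩

theorem curveSpeed_cappedSurface (hf : IsCapProfile ρs f) (hρs : ρs < Real.log 2)
    (hγ : Set.range γ ⊆ thickPart ρs) (t : ℝ) :
    curveSpeed (cappedSurface ρs f) γ t = curveSpeed hypSurface γ t := by
  have hrad : ∀ s, Real.exp ρs < radius (γ s) := fun s =>
    (mem_thickPart_iff hρs _).1 (hγ ⟨s, rfl⟩)
  refine le_antisymm ?_ ?_
  · refine le_iInf₂ fun P hP => le_iInf₂ fun c hc => ?_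
    obtain rfl : P = hypPatch := hP
    exact iInf₂_le_of_le (thickPatch ρs) (Or.inl (Or.inl rfl)) <|
      iInf₂_le_of_le c (thickPatch_isLift_iff.2 ⟨hc, .of_forall fun s => hγ ⟨s, rfl⟩⟩) le_rfl
  · refine le_iInf₂ fun P hP => le_iInf₂ fun c hc => ?_
    rcases hP with (rfl | ⟨i, rfl⟩) | ⟨i, rfl⟩
    · exact iInf₂_le_of_le hypPatch rfl <|
        iInf₂_le_of_le c (thickPatch_isLift_iff.1 hc).1 le_rfl
    · obtain ⟨c', hc', hlen, -⟩ := exists_hypPatch_isLift_of_cuspPatch hc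
        (eventually_eventuallyEq_one_of_cuspPatch hf hc (.of_forall hrad))
      rw [← hlen]
      exact iInf₂_le_of_le hypPatch rfl <| iInf₂_le_of_le c' hc' le_rfl
    · have h1 := (eventually_radius_eq_of_flatPatch hρs hc).self_of_nhds.1
      have h2 := (hrad t).trans h1
      rw [Real.exp_lt_exp] at h2
      linarith

theorem isClosedGeodesic_cappedSurface_iff (hf : IsCapProfile ρs f) (hρs : ρs < Real.log 2)
    (hγ : Set.range γ ⊆ thickPart ρs) (T : ℝ) :
    IsClosedGeodesic (cappedSurface ρs f) γ T ↔ IsClosedGeodesic hypSurface γ T := by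
  simp only [IsClosedGeodesic, isGeodesic_cappedSurface_iff hf hρs hγ]

theorem closedLength_cappedSurface (hf : IsCapProfile ρs f) (hρs : ρs < Real.log 2)
    (hγ : Set.range γ ⊆ thickPart ρs) (T : ℝ) :
    closedLength (cappedSurface ρs f) γ T = closedLength hypSurface γ T := by
  simp only [closedLength, curveSpeed_cappedSurface hf hρs hγ]

/-! ### The radial speed in the collars -/

/-- In a lift to the horoball about `∞`, `log radius = log 2 - log Im w`, whose derivative is at
most `|w'| / Im w` in absolute value. -/
theorem hasDerivAt_log_radius_of_hypPatch (hc : hypPatch.IsLift c γ t) (hγ : radius (γ t) < 2) :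
    ∃ d, HasDerivAt (fun s => Real.log (radius (γ s))) d t ∧
      |d| ≤ hypPatch.vecLength (c t) (deriv c t) := by
  obtain ⟨w, hw, hlen, hev, -⟩ := exists_curve_of_hypPatch_isLift hc hγ
  have hpos : 0 < (w t).im := one_pos.trans hev.self_of_nhds.1
  have him : HasDerivAt (fun s => (w s).im) (deriv w t).im t :=
    Complex.imCLM.hasFDerivAt.comp_hasDerivAt t (hw.differentiableAt (by norm_num)).hasDerivAt
  refine ⟨0 - (deriv w t).im / (w t).im, ?_, ?_⟩
  · refine ((hasDerivAt_const t (Real.log 2)).sub (him.log hpos.ne')).congr_of_eventuallyEq ?_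
    filter_upwards [hev] with s hs
    rw [hs.2.1, Real.log_div two_ne_zero (one_pos.trans hs.1).ne']
    rfl
  · rw [hlen, zero_sub, abs_neg, abs_div, abs_of_pos hpos]
    gcongr
    exact Complex.abs_im_le_norm _

theorem hasDerivAt_log_radius_of_mem_cappedSurface (hf : IsCapProfile ρs f) (hρs : ρs < Real.log 2)
    {P : Patch Sphere3} (hP : P ∈ cappedSurface ρs f) (hc : P.IsLift c γ t)
    (hγ : Real.exp ρs < radius (γ t)) (hγ' : radius (γ t) < 2) :
    ∃ d, HasDerivAt (fun s => Real.log (radius (γ s))) d t ∧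
      |d| ≤ P.vecLength (c t) (deriv c t) := by
  rcases hP with (rfl | ⟨i, rfl⟩) | ⟨i, rfl⟩
  · exact hasDerivAt_log_radius_of_hypPatch (thickPatch_isLift_iff.1 hc).1 hγ'
  · have hev := eventually_radius_eq_of_cuspPatch hc
    have ht := hev.self_of_nhds
    rw [ht.2, Real.exp_lt_exp] at hγ
    refine ⟨deriv c t 0, ?_, ?_⟩
    · refine (hasDerivAt_pi.1 (hc.1.differentiableAt (by norm_num)).hasDerivAt 0).congr_of_eventuallyEq
        (hev.mono fun s hs => ?_)
      simp only [hs.2, Real.log_exp]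
    · rw [Patch.vecLength_of_diagonal (P := cuspPatch f i) rfl, hf.eq_one _ ⟨hγ.le, ht.1.le⟩]
      refine Real.abs_le_sqrt ?_
      have := mul_nonneg (Real.exp_pos (2 * c t 0)).le (sq_nonneg (deriv c t 1))
      linarith
  · have h1 := (eventually_radius_eq_of_flatPatch hρs hc).self_of_nhds.1
    have h2 := hγ.trans h1
    rw [Real.exp_lt_exp] at h2
    linarith

end Patches

/-! ### Lengths of arcs that cross a collar -/

section Length

open MeasureTheory

/-- A lift translated by the period is again a lift, with the same velocity. The inequality
suffices, since it also applies to `-T`. -/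
theorem curveSpeed_add_le {X : Type*} (A : Set (Patch X)) {γ : ℝ → X} {T : ℝ}
    (hT : Function.Periodic γ T) (t : ℝ) : curveSpeed A γ (t + T) ≤ curveSpeed A γ t := by
  refine le_iInf₂ fun P hP => le_iInf₂ fun c hc => ?_
  have hcont : Filter.Tendsto (fun s => s - T) (𝓝 (t + T)) (𝓝 t) := by
    have : ContinuousAt (fun s : ℝ => s - T) (t + T) := by fun_prop
    simpa [ContinuousAt] using this
  have hlift : P.IsLift (fun s => c (s - T)) γ (t + T) := by
    refine ⟨?_, ?_⟩
    · refine ContDiffAt.comp (t + T) (g := c) (f := fun s => s - T) ?_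
        (contDiffAt_id.sub contDiffAt_const)
      rw [add_sub_cancel_right]
      exact hc.1
    · filter_upwards [hcont.eventually hc.2] with s hs
      rw [hT.sub_eq] at hs
      exact hs
  refine iInf₂_le_of_le P hP <| iInf₂_le_of_le _ hlift ?_
  simp only [deriv_comp_sub_const, add_sub_cancel_right, le_refl]

theorem periodic_curveSpeed {X : Type*} (A : Set (Patch X)) {γ : ℝ → X} {T : ℝ}
    (hT : Function.Periodic γ T) : Function.Periodic (curveSpeed A γ) T := fun t => by
  refine le_antisymm (curveSpeed_add_le A hT t) ?_
  simpa using curveSpeed_add_le A hT.neg (t + T)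

theorem setLIntegral_Ioc_le_closedLength {X : Type*} (A : Set (Patch X)) {γ : ℝ → X} {T : ℝ}
    (hT : 0 < T) (hγ : Function.Periodic γ T) {a b : ℝ} (hab : b ≤ a + T) :
    ∫⁻ t in Set.Ioc a b, curveSpeed A γ t ≤ closedLength A γ T := by
  have h : ∫⁻ t in Set.Ioc a (a + T), curveSpeed A γ t = ∫⁻ t in Set.Ioc 0 (0 + T), curveSpeed A γ t :=
    (isAddFundamentalDomain_Ioc hT a).setLIntegral_eq (isAddFundamentalDomain_Ioc hT 0) _
      (periodic_curveSpeed A hγ).map_vadd_zmultiples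
  rw [zero_add] at h
  rw [closedLength, ← h]
  exact lintegral_mono_set (Set.Ioc_subset_Ioc_right hab)

/-- If the integral of `|ψ'|` is infinite there is nothing to prove; otherwise `ψ'` is integrable
and the fundamental theorem of calculus applies. Only `deriv ψ` has to be measurable, so `v` may be
an infimum over lifts. -/
theorem ofReal_sub_le_lintegral {ψ : ℝ → ℝ} {a b : ℝ} (hab : a ≤ b)
    (hψ : ContinuousOn ψ (Set.Icc a b)) {v : ℝ → ℝ≥0∞}
    (hd : ∀ t ∈ Set.Ioo a b, ∃ d, HasDerivAt ψ d t ∧ ENNReal.ofReal |d| ≤ v t) :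
    ENNReal.ofReal (ψ b - ψ a) ≤ ∫⁻ t in Set.Ioc a b, v t := by
  have h1 : ∫⁻ t in Set.Ioc a b, ‖deriv ψ t‖ₑ ≤ ∫⁻ t in Set.Ioc a b, v t := by
    rw [← restrict_Ioo_eq_restrict_Ioc]
    refine setLIntegral_mono' measurableSet_Ioo fun t ht => ?_
    obtain ⟨d, hd1, hd2⟩ := hd t ht
    rwa [hd1.deriv, ← ofReal_norm, Real.norm_eq_abs]
  refine le_trans ?_ h1
  by_cases hfin : ∫⁻ t in Set.Ioc a b, ‖deriv ψ t‖ₑ = ⊤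
  · rw [hfin]; exact le_top
  · have hint : IntegrableOn (deriv ψ) (Set.Ioc a b) :=
      ⟨(measurable_deriv ψ).aestronglyMeasurable, lt_top_iff_ne_top.2 hfin⟩
    have hFTC : ∫ t in a..b, deriv ψ t = ψ b - ψ a :=
      intervalIntegral.integral_eq_sub_of_hasDerivAt_of_le hab hψ (fun t ht => by
        obtain ⟨d, hd1, -⟩ := hd t ht
        rwa [hd1.deriv]) ((intervalIntegrable_iff_integrableOn_Ioc_of_le hab).2 hint)
    rw [← hFTC, intervalIntegral.integral_of_le hab]
    refine (ENNReal.ofReal_le_ofReal (Real.le_norm_self _)).trans ?_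
    rw [ofReal_norm]
    exact enorm_integral_le_lintegral_enorm _

/-- A continuous function that takes values `≤ x` and, later, `≥ y > x` passes from `x` to `y`. -/
theorem exists_crossing {g : ℝ → ℝ} (hg : Continuous g) {x y a b : ℝ} (hxy : x < y) (hab : a ≤ b)
    (ha : g a ≤ x) (hb : y ≤ g b) :
    ∃ a' b', a ≤ a' ∧ a' ≤ b' ∧ b' ≤ b ∧ g a' = x ∧ g b' = y ∧
      ∀ s ∈ Set.Ioo a' b', x < g s ∧ g s < y := by
  -- `b'` is the first time at which `g` reaches `y`, and `a'` the last time before it at which `g ≤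
  -- x`.
  have hS : IsCompact (Set.Icc a b ∩ g ⁻¹' Set.Ici y) :=
    isCompact_Icc.inter_right (isClosed_Ici.preimage hg)
  obtain ⟨b', ⟨hb'1, hb'2⟩, hb'min⟩ := hS.exists_isLeast ⟨b, ⟨hab, le_rfl⟩, hb⟩
  have hlt : ∀ s ∈ Set.Ico a b', g s < y := fun s hs => by
    by_contra! h
    exact absurd (hb'min ⟨⟨hs.1, hs.2.le.trans hb'1.2⟩, h⟩) hs.2.not_ge
  have hS' : IsCompact (Set.Icc a b' ∩ g ⁻¹' Set.Iic x) :=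
    isCompact_Icc.inter_right (isClosed_Iic.preimage hg)
  obtain ⟨a', ⟨ha'1, ha'2⟩, ha'max⟩ := hS'.exists_isGreatest ⟨a, ⟨le_rfl, hb'1.1⟩, ha⟩
  have hgt : ∀ s ∈ Set.Ioc a' b', x < g s := fun s hs => by
    by_contra! h
    exact absurd (ha'max ⟨⟨ha'1.1.trans hs.1.le, hs.2⟩, h⟩) hs.1.not_ge
  refine ⟨a', b', ha'1.1, ha'1.2, hb'1.2, le_antisymm ha'2 ?_, le_antisymm ?_ hb'2, fun s hs =>
    ⟨hgt s ⟨hs.1, hs.2.le⟩, hlt s ⟨ha'1.1.trans hs.1.le, hs.2⟩⟩⟩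
  · by_contra! h
    obtain ⟨s, hs, hsx⟩ := intermediate_value_Ioo ha'1.2 hg.continuousOn ⟨h, hxy.trans_le hb'2⟩
    exact (hgt s ⟨hs.1, hs.2.le⟩).ne' hsx
  · by_contra! h
    obtain ⟨s, hs, hsx⟩ := intermediate_value_Ioo hb'1.1 hg.continuousOn ⟨ha.trans_lt hxy, h⟩
    exact (hlt s ⟨hs.1.le, hs.2⟩).ne hsx

/-- The collar has width `log 2 - ρ_*` and `log radius` varies at most at unit rate in arc length.
The family of patches is arbitrary, so both metrics are covered. -/
theorem log_two_sub_le_closedLength {A : Set (Patch Sphere3)} {γ : ℝ → Sphere3} {T ρs : ℝ}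
    (hγ : IsClosedGeodesic A γ T) (hρs : ρs < Real.log 2)
    (hcont : ∀ P ∈ A, ∀ c t, P.IsLift c γ t → ContinuousAt (fun s => radius (γ s)) t)
    (hspeed : ∀ P ∈ A, ∀ c t, P.IsLift c γ t → Real.exp ρs < radius (γ t) → radius (γ t) < 2 →
      ∃ d, HasDerivAt (fun s => Real.log (radius (γ s))) d t ∧
        |d| ≤ P.vecLength (c t) (deriv c t))
    (hlow : ∃ t, radius (γ t) ≤ Real.exp ρs) (hhigh : ∃ t, 2 ≤ radius (γ t)) :
    ENNReal.ofReal (Real.log 2 - ρs) ≤ closedLength A γ T := by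
  obtain ⟨hT, hper, hgeo, -⟩ := hγ
  obtain ⟨t₁, h₁⟩ := hlow
  obtain ⟨t₂, h₂⟩ := hhigh
  have hg : Continuous fun s => radius (γ s) := continuous_iff_continuousAt.2 fun t => by
    obtain ⟨P, hP, c, hc, -⟩ := hgeo t
    exact hcont P hP c t hc
  -- The high point is moved into the period starting at the low point, so the crossing arc is
  -- counted at most once in the length.
  obtain ⟨t₃, ht₃, h₃⟩ := hper.exists_mem_Ico hT t₂ t₁
  rw [h₃] at h₂
  have h2 : Real.exp ρs < 2 := by rwa [Real.lt_log_iff_exp_lt two_pos] at hρs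
  obtain ⟨a, b, ha, hab, hb, hga, hgb, hmid⟩ := exists_crossing hg h2 ht₃.1 h₁ h₂
  have hpos : ∀ s ∈ Set.Icc a b, 0 < radius (γ s) := fun s hs => by
    rcases hs.1.eq_or_lt with rfl | h
    · exact (Real.exp_pos ρs).trans_eq hga.symm
    · rcases hs.2.eq_or_lt with rfl | h'
      · exact two_pos.trans_eq hgb.symm
      · exact (Real.exp_pos ρs).trans (hmid s ⟨h, h'⟩).1
  have key := ofReal_sub_le_lintegral (ψ := fun s => Real.log (radius (γ s)))
    (v := curveSpeed A γ) hab (hg.continuousOn.log fun s hs => (hpos s hs).ne') fun t ht => by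
      obtain ⟨P, hP, c, hc, -⟩ := hgeo t
      obtain ⟨d, hd, -⟩ := hspeed P hP c t hc (hmid t ht).1 (hmid t ht).2
      -- The speed is an infimum over all lifts; uniqueness of the derivative lets each of them
      -- bound the same `|d|`.
      refine ⟨d, hd, le_iInf₂ fun P' hP' => le_iInf₂ fun c' hc' => ?_⟩
      obtain ⟨d', hd', hle⟩ := hspeed P' hP' c' t hc' (hmid t ht).1 (hmid t ht).2
      rw [hd.unique hd']
      exact ENNReal.ofReal_le_ofReal hle
  simp only [hga, hgb, Real.log_exp] at key
  exact key.trans (setLIntegral_Ioc_le_closedLength A hT hper (by linarith [ht₃.2]))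

end Length

end

noncomputable section

/-! ### Closed geodesics leave the cusps -/

/-- Near time `t`, the function `φ` is `C²` with nonnegative second derivative, which vanishes only
where the curve `c` is stationary. -/
def ConvexAlong (φ : ℝ → ℝ) (c : ℝ → Fin 2 → ℝ) (t : ℝ) : Prop :=
  ∃ u v : ℝ → ℝ, ∀ᶠ s in 𝓝 t, HasDerivAt φ (u s) s ∧ HasDerivAt u (v s) s ∧ 0 ≤ v s ∧
    (v s = 0 → deriv c s = 0)

/-- The derivative is both monotone and periodic, hence constant. -/
theorem Function.Periodic.deriv_deriv_eq_zero {φ : ℝ → ℝ} {T : ℝ} (hT : 0 < T)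
    (hper : Function.Periodic φ T)
    (h : ∀ t, HasDerivAt (_root_.deriv φ) (_root_.deriv (_root_.deriv φ) t) t ∧
      0 ≤ _root_.deriv (_root_.deriv φ) t) (t : ℝ) :
    _root_.deriv (_root_.deriv φ) t = 0 := by
  have hmono : Monotone (_root_.deriv φ) :=
    monotone_of_deriv_nonneg (fun t => (h t).1.differentiableAt) fun t => (h t).2
  have hper' : Function.Periodic (_root_.deriv φ) T := fun t => by
    rw [← deriv_comp_add_const, funext hper]
  have hconst : ∀ x y, _root_.deriv φ x ≤ _root_.deriv φ y := fun x y => by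
    obtain ⟨z, hz, hxz⟩ := hper'.exists_mem_Ico hT x (y - T)
    rw [hxz]
    exact hmono (by linarith [hz.2])
  have : _root_.deriv φ = fun _ => _root_.deriv φ 0 :=
    funext fun x => le_antisymm (hconst _ _) (hconst _ _)
  rw [this, deriv_const]

/-- Along a closed geodesic `Φ` would be periodic and convex, so its second derivative vanishes and
every local lift is stationary. The curve is then locally constant, hence constant, since `ℝ` is
connected. -/
theorem not_isClosedGeodesic_of_convexAlong {X : Type*} {A : Set (Patch X)} {γ : ℝ → X} {T : ℝ}
    (Φ : X → ℝ) (hΦ : ∀ t, ∀ P ∈ A, ∀ c, P.IsLift c γ t → (∀ᶠ s in 𝓝 t, P.GeodesicEq c s) →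
      ConvexAlong (fun s => Φ (γ s)) c t) : ¬ IsClosedGeodesic A γ T := by
  rintro ⟨hT, hper, hgeo, x, y, hxy⟩
  have hD : ∀ t, HasDerivAt (deriv fun s => Φ (γ s)) (deriv (deriv fun s => Φ (γ s)) t) t ∧
      0 ≤ deriv (deriv fun s => Φ (γ s)) t := fun t => by
    obtain ⟨P, hP, c, hc, hg⟩ := hgeo t
    obtain ⟨u, v, huv⟩ := hΦ t P hP c hc hg
    have h := eventually_deriv_eq_of_hasDerivAt (huv.mono fun s hs => And.intro hs.1 hs.2.1)
    have hu : deriv (fun s => Φ (γ s)) =ᶠ[𝓝 t] u := h.mono fun s hs => hs.1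
    rw [h.self_of_nhds.2]
    exact ⟨huv.self_of_nhds.2.1.congr_of_eventuallyEq hu, huv.self_of_nhds.2.2.1⟩
  have hper' : Function.Periodic (fun s => Φ (γ s)) T := fun s => by simp only [hper s]
  have h0 := hper'.deriv_deriv_eq_zero hT hD
  have hloc : IsLocallyConstant γ := by
    rw [IsLocallyConstant.iff_eventually_eq]
    intro t
    obtain ⟨P, hP, c, hc, hg⟩ := hgeo t
    obtain ⟨u, v, huv⟩ := hΦ t P hP c hc hg
    have h := eventually_deriv_eq_of_hasDerivAt (huv.mono fun s hs => And.intro hs.1 hs.2.1)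
    have hd : ∀ᶠ s in 𝓝 t, HasDerivAt c 0 s ∧ γ s = P.toFun (c s) := by
      filter_upwards [huv, h, hc.1.eventually_hasDerivAt_two, hc.2] with s h1 h2 h3 h4
      have hv : v s = 0 := by rw [← h2.2, h0]
      exact ⟨by simpa only [h1.2.2.2 hv] using h3.2.1, h4.2⟩
    obtain ⟨ε, hε, hball⟩ := Metric.eventually_nhds_iff_ball.1 hd
    filter_upwards [Metric.ball_mem_nhds t hε] with s hs
    have hcs : c s = c t := by
      refine (convex_ball t ε).is_const_of_fderivWithin_eq_zero (𝕜 := ℝ) (f := c)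
        (fun r hr => (hball r hr).1.differentiableAt.differentiableWithinAt) (fun r hr => ?_) hs
        (Metric.mem_ball_self hε)
      rw [fderivWithin_of_isOpen Metric.isOpen_ball hr]
      ext1
      simpa using (hball r hr).1.deriv
    rw [(hball s hs).2, hcs, ← (hball t (Metric.mem_ball_self hε)).2]
  exact hxy (hloc.apply_eq_of_preconnectedSpace x y)

theorem HypGeodesicEq.im_eq {w : ℝ → ℂ} {s : ℝ} (h : HypGeodesicEq w s) :
    (deriv (deriv w) s).im * (w s).im = (deriv w s).im ^ 2 - (deriv w s).re ^ 2 := by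
  have h1 := congrArg Complex.im h
  simp only [pow_two, Complex.mul_re, Complex.mul_im, Complex.neg_re,
    Complex.neg_im, Complex.I_re, Complex.I_im, Complex.ofReal_re, Complex.ofReal_im] at h1
  linear_combination h1

theorem eventually_hasDerivAt_im {w : ℝ → ℂ} {t : ℝ} (hw : ContDiffAt ℝ 2 w t) :
    ∀ᶠ s in 𝓝 t, HasDerivAt (fun s => (w s).im) (deriv w s).im s ∧
      HasDerivAt (fun s => (deriv w s).im) (deriv (deriv w) s).im s := by
  filter_upwards [hw.eventually_hasDerivAt_two] with s hs
  exact ⟨Complex.imCLM.hasFDerivAt.comp_hasDerivAt s hs.2.1,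
    Complex.imCLM.hasFDerivAt.comp_hasDerivAt s hs.2.2⟩

/-- Here `radius = 2/y`, and `y y'' = y'² - x'²` gives `(2/y)'' = 2(x'² + y'²)/y³`. -/
theorem convexAlong_radius_of_hypPatch {c : ℝ → Fin 2 → ℝ} {γ : ℝ → Sphere3} {t : ℝ}
    (hc : hypPatch.IsLift c γ t) (hgeo : ∀ᶠ s in 𝓝 t, hypPatch.GeodesicEq c s)
    (hγ : radius (γ t) < 2) : ConvexAlong (fun s => radius (γ s)) c t := by
  obtain ⟨w, hw, -, hev, hgw⟩ := exists_curve_of_hypPatch_isLift hc hγ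
  refine ⟨fun s => -2 * (deriv w s).im / (w s).im ^ 2,
    fun s => 2 * ((deriv w s).re ^ 2 + (deriv w s).im ^ 2) / (w s).im ^ 3, ?_⟩
  filter_upwards [hev.eventually_nhds, hgw hgeo, eventually_hasDerivAt_im hw] with s hs hg ⟨h1, h2⟩
  obtain ⟨hy, -, hstat⟩ := hs.self_of_nhds
  have hpos : 0 < (w s).im := one_pos.trans hy
  have him := hg.im_eq
  refine ⟨?_, ?_, by positivity, fun h0 => hstat ?_⟩
  · refine HasDerivAt.congr_of_eventuallyEq ?_ (hs.mono fun r hr => hr.2.1)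
    refine ((hasDerivAt_const s (2 : ℝ)).div h1 hpos.ne').congr_deriv ?_
    ring
  · refine ((h2.const_mul (-2)).div (h1.fun_pow 2) (pow_ne_zero 2 hpos.ne')).congr_deriv ?_
    field_simp
    push_cast
    linear_combination (-(w s).im) * him
  · rw [div_eq_zero_iff, or_iff_left (pow_ne_zero 3 hpos.ne')] at h0
    apply Complex.ext
    · simp only [Complex.zero_re]
      nlinarith [sq_nonneg (deriv w s).re, sq_nonneg (deriv w s).im]
    · simp only [Complex.zero_im]
      nlinarith [sq_nonneg (deriv w s).re, sq_nonneg (deriv w s).im]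

theorem IsClosedGeodesic.exists_two_le_radius_hyp {γ : ℝ → Sphere3} {T : ℝ}
    (hγ : IsClosedGeodesic hypSurface γ T) : ∃ t, 2 ≤ radius (γ t) := by
  by_contra! h
  refine not_isClosedGeodesic_of_convexAlong (A := hypSurface) radius (fun t P hP c hc hgeo => ?_) hγ
  obtain rfl : P = hypPatch := hP
  exact convexAlong_radius_of_hypPatch hc hgeo (h t)

/-! ### The distance to a puncture in the capped metric -/

section Cap

variable {ρs : ℝ} {f : ℝ → ℝ}

/-- The distance from the puncture to the circle at `ρ` in the metric of profile `f`. -/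
def capDist (ρs : ℝ) (f : ℝ → ℝ) (ρ : ℝ) : ℝ :=
  Real.exp (ρs - 1) / (2 * Real.pi) + ∫ x in (ρs - 1)..ρ, f x

theorem IsCapProfile.intervalIntegrable (hf : IsCapProfile ρs f) {a b : ℝ} (ha : a ≤ Real.log 2)
    (hb : b ≤ Real.log 2) : IntervalIntegrable f MeasureTheory.volume a b :=
  (hf.smooth.continuousOn.mono fun _ hx => (Set.mem_uIcc.1 hx).elim
    (fun h => h.2.trans hb) fun h => h.2.trans ha).intervalIntegrable

theorem IsCapProfile.hasDerivAt_capDist (hf : IsCapProfile ρs f) (hρs : ρs < Real.log 2) {ρ : ℝ}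
    (hρ : ρ < Real.log 2) : HasDerivAt (capDist ρs f) (f ρ) ρ := by
  have hopen : ContinuousOn f (Set.Iio (Real.log 2)) :=
    hf.smooth.continuousOn.mono Set.Iio_subset_Iic_self
  refine (intervalIntegral.integral_hasDerivAt_right
    (hf.intervalIntegrable (by linarith) hρ.le)
    (hopen.stronglyMeasurableAtFilter isOpen_Iio ρ hρ)
    (hopen.continuousAt (Iio_mem_nhds hρ))).const_add _

/-- The constant in `capDist` is the radius of the flat disc, so inside it the integral leaves
exactly the Euclidean radius. -/
theorem IsCapProfile.capDist_of_le (hf : IsCapProfile ρs f) {ρ : ℝ} (hρ : ρ ≤ ρs - 1) :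
    capDist ρs f ρ = Real.exp ρ / (2 * Real.pi) := by
  have h : ∫ x in (ρs - 1)..ρ, f x = ∫ x in (ρs - 1)..ρ, Real.exp x / (2 * Real.pi) := by
    refine intervalIntegral.integral_congr fun x hx => hf.eq_exp x ?_
    rw [Set.uIcc_of_ge hρ] at hx
    exact hx.2
  rw [capDist, h, intervalIntegral.integral_div, integral_exp]
  ring

theorem IsCapProfile.capDist_pos (hf : IsCapProfile ρs f) {ρ : ℝ}
    (hρ : ρ < Real.log 2) : 0 < capDist ρs f ρ := by
  rcases le_total ρ (ρs - 1) with h | h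
  · rw [hf.capDist_of_le h]
    positivity
  · have : 0 ≤ ∫ x in (ρs - 1)..ρ, f x :=
      intervalIntegral.integral_nonneg h fun x hx => (hf.pos x (hx.2.trans hρ.le)).le
    rw [capDist]
    positivity

theorem IsCapProfile.hasDerivAt (hf : IsCapProfile ρs f) {ρ : ℝ} (hρ : ρ < Real.log 2) :
    HasDerivAt f (deriv f ρ) ρ :=
  ((hf.smooth.contDiffAt (Iic_mem_nhds hρ)).differentiableAt (by simp)).hasDerivAt

/-- The square of the distance to the puncture, as a function on the sphere. -/
def sqCapDist (ρs : ℝ) (f : ℝ → ℝ) (q : Sphere3) : ℝ :=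
  if radius q = 0 then 0 else capDist ρs f (Real.log (radius q)) ^ 2

/-- Write `D` for `capDist`, so `(D ∘ r)' = f r'`. The geodesic equation gives `(f r')' = exp (2r)
a² / f ≥ 0`, whence `(D²)'' = 2(f r')² + 2D exp (2r) a² / f`. The square makes this positive on
radial geodesics too, and is smooth across the puncture. The functions `r` and `a` stand for `ρ` and
`θ'`, in whichever patch they arise. -/
theorem convexAlong_sqCapDist (hf : IsCapProfile ρs f) (hρs : ρs < Real.log 2) {γ : ℝ → Sphere3}
    {c : ℝ → Fin 2 → ℝ} {t : ℝ} {r r₁ r₂ a : ℝ → ℝ}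
    (h : ∀ᶠ s in 𝓝 t, r s < Real.log 2 ∧ radius (γ s) = Real.exp (r s) ∧
      HasDerivAt r (r₁ s) s ∧ HasDerivAt r₁ (r₂ s) s ∧
      f (r s) ^ 2 * r₂ s + f (r s) * deriv f (r s) * r₁ s ^ 2 = Real.exp (2 * r s) * a s ^ 2 ∧
      (r₁ s = 0 → a s = 0 → deriv c s = 0)) :
    ConvexAlong (fun s => sqCapDist ρs f (γ s)) c t := by
  refine ⟨fun s => 2 * capDist ρs f (r s) * (f (r s) * r₁ s),
    fun s => 2 * f (r s) ^ 2 * r₁ s ^ 2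
      + 2 * capDist ρs f (r s) * (Real.exp (2 * r s) * a s ^ 2 / f (r s)), ?_⟩
  filter_upwards [h.eventually_nhds] with s hs
  obtain ⟨hr, -, h1, h2, heq, hstat⟩ := hs.self_of_nhds
  have hD := (hf.hasDerivAt_capDist hρs hr).comp s h1
  have hF := (hf.hasDerivAt hr).comp s h1
  have hDpos := hf.capDist_pos hr
  have hfpos := hf.pos _ hr.le
  have hexp := Real.exp_pos (2 * r s)
  have hfirst : HasDerivAt (fun s => capDist ρs f (r s) ^ 2)
      (2 * capDist ρs f (r s) * (f (r s) * r₁ s)) s := by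
    simpa using hD.fun_pow 2
  refine ⟨hfirst.congr_of_eventuallyEq (hs.mono fun x hx => ?_), ?_, by positivity, fun h0 => ?_⟩
  · simp only [sqCapDist, hx.2.1, (Real.exp_pos _).ne', if_false, Real.log_exp]
  · refine ((hD.const_mul 2).mul (hF.mul h2)).congr_deriv ?_
    simp only [Function.comp_apply, Pi.mul_apply]
    field_simp
    linear_combination (capDist ρs f (r s)) * heq
  · have h3 : 0 ≤ 2 * f (r s) ^ 2 * r₁ s ^ 2 := by positivity
    have h4 : 0 ≤ 2 * capDist ρs f (r s) * (Real.exp (2 * r s) * a s ^ 2 / f (r s)) := by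
      positivity
    obtain ⟨h5, h6⟩ := (add_eq_zero_iff_of_nonneg h3 h4).1 h0
    refine hstat ?_ ?_
    · simpa [hfpos.ne'] using h5
    · simpa [hfpos.ne', hDpos.ne'] using h6

/-- In the flat disc the function is `|c|²`, and geodesics have `c'' = 0`, so its second derivative
is `2|c'|²`. This covers passage through the puncture. -/
theorem convexAlong_sqCapDist_of_flatPatch (hf : IsCapProfile ρs f) (hρs : ρs < Real.log 2)
    {γ : ℝ → Sphere3} {c : ℝ → Fin 2 → ℝ} {t : ℝ} {i : Fin 3} (hc : (flatPatch ρs i).IsLift c γ t)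
    (hgeo : ∀ᶠ s in 𝓝 t, (flatPatch ρs i).GeodesicEq c s) :
    ConvexAlong (fun s => sqCapDist ρs f (γ s)) c t := by
  have hval : ∀ᶠ s in 𝓝 t, sqCapDist ρs f (γ s) = c s 0 ^ 2 + c s 1 ^ 2 := by
    filter_upwards [eventually_radius_eq_of_flatPatch hρs hc] with s ⟨h1, h2⟩
    have hn : ‖toComplexCurve c s‖ ^ 2 = c s 0 ^ 2 + c s 1 ^ 2 := by
      rw [Complex.sq_norm, toComplexCurve, Complex.normSq_mk]
      ring
    rw [sqCapDist]
    split_ifs with h0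
    · rw [h0, zero_eq_mul, or_iff_right (by positivity)] at h2
      rw [← hn, h2]
      simp
    · have hpos : 0 < radius (γ s) := lt_of_le_of_ne (h2 ▸ by positivity) (Ne.symm h0)
      rw [hf.capDist_of_le ((Real.log_lt_iff_lt_exp hpos).2 h1).le, Real.exp_log hpos, h2, ← hn]
      congr 1
      field_simp
  have hmetric : (flatPatch ρs i).metric = fun _ => Matrix.diagonal ![1, 1] := by
    funext q
    change (1 : Matrix (Fin 2) (Fin 2) ℝ) = _
    rw [← Matrix.diagonal_one]
    congr 1
    ext k
    fin_cases k <;> rfl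
  refine ⟨fun s => 2 * (c s 0 * deriv c s 0 + c s 1 * deriv c s 1),
    fun s => 2 * (deriv c s 0 ^ 2 + deriv c s 1 ^ 2), ?_⟩
  filter_upwards [hval.eventually_nhds, hgeo, hc.1.eventually_hasDerivAt_two] with s hs hg ⟨_, h1, h2⟩
  have h1 := hasDerivAt_pi.1 h1
  have h2 := hasDerivAt_pi.1 h2
  rw [Patch.geodesicEq_iff_of_diagonal (E := fun _ => 1) (G := fun _ => 1) hmetric c s one_ne_zero
    one_ne_zero (E0 := 0) (E1 := 0) (G0 := 0) (G1 := 0) (by simp) (by simp) (by simp) (by simp)] at hg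
  refine ⟨?_, ?_, by positivity, fun h0 => ?_⟩
  · refine HasDerivAt.congr_of_eventuallyEq ?_ hs
    refine (((h1 0).fun_pow 2).add ((h1 1).fun_pow 2)).congr_deriv ?_
    push_cast
    ring
  · refine ((((h1 0).mul (h2 0)).add ((h1 1).mul (h2 1))).const_mul 2).congr_deriv ?_
    linear_combination c s 0 * hg.1 + c s 1 * hg.2
  · ext k
    fin_cases k
    · change deriv c s 0 = 0
      nlinarith [sq_nonneg (deriv c s 0), sq_nonneg (deriv c s 1)]
    · change deriv c s 1 = 0
      nlinarith [sq_nonneg (deriv c s 0), sq_nonneg (deriv c s 1)]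

theorem convexAlong_sqCapDist_of_cuspPatch (hf : IsCapProfile ρs f) (hρs : ρs < Real.log 2)
    {γ : ℝ → Sphere3} {c : ℝ → Fin 2 → ℝ} {t : ℝ} {i : Fin 3} (hc : (cuspPatch f i).IsLift c γ t)
    (hgeo : ∀ᶠ s in 𝓝 t, (cuspPatch f i).GeodesicEq c s) :
    ConvexAlong (fun s => sqCapDist ρs f (γ s)) c t := by
  refine convexAlong_sqCapDist hf hρs (r := fun s => c s 0) (r₁ := fun s => deriv c s 0)
    (r₂ := fun s => deriv (deriv c) s 0) (a := fun s => deriv c s 1) ?_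
  filter_upwards [eventually_radius_eq_of_cuspPatch hc, hgeo, hc.1.eventually_hasDerivAt_two]
    with s hs hg ⟨_, h1, h2⟩
  rw [cuspPatch_geodesicEq_iff i (hf.hasDerivAt hs.1) (hf.pos _ hs.1.le)] at hg
  refine ⟨hs.1, hs.2, hasDerivAt_pi.1 h1 0, hasDerivAt_pi.1 h2 0, hg.1, fun h3 h4 => ?_⟩
  ext k
  fin_cases k
  · exact h3
  · exact h4

theorem convexAlong_sqCapDist_of_thickPatch (hf : IsCapProfile ρs f) (hρs : ρs < Real.log 2)
    {γ : ℝ → Sphere3} {c : ℝ → Fin 2 → ℝ} {t : ℝ} (hc : (thickPatch ρs).IsLift c γ t)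
    (hgeo : ∀ᶠ s in 𝓝 t, (thickPatch ρs).GeodesicEq c s) (hγ : radius (γ t) < 2) :
    ConvexAlong (fun s => sqCapDist ρs f (γ s)) c t := by
  obtain ⟨hc', hthick⟩ := thickPatch_isLift_iff.1 hc
  obtain ⟨w, hw, -, hev, hgw⟩ := exists_curve_of_hypPatch_isLift hc' hγ
  -- Horocyclic coordinates of `w = x + iy`: `ρ = log 2 - log y` and `θ = x/2`; the geodesic
  -- equation gives `ρ'' = x'²/y²`.
  refine convexAlong_sqCapDist hf hρs (r := fun s => Real.log 2 - Real.log (w s).im)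
    (r₁ := fun s => -((deriv w s).im / (w s).im)) (r₂ := fun s => (deriv w s).re ^ 2 / (w s).im ^ 2)
    (a := fun s => (deriv w s).re / 2) ?_
  filter_upwards [hev, hgw hgeo, eventually_hasDerivAt_im hw, hthick]
    with s ⟨hy, hrad, hstat⟩ hg ⟨h1, h2⟩ hth
  have hpos : 0 < (w s).im := one_pos.trans hy
  have him := hg.im_eq
  have hlt : Real.log 2 - Real.log (w s).im < Real.log 2 := by
    linarith [Real.log_pos hy]
  have hexp : Real.exp (Real.log 2 - Real.log (w s).im) = 2 / (w s).im := by
    rw [Real.exp_sub, Real.exp_log two_pos, Real.exp_log hpos]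
  have hone : f =ᶠ[𝓝 (Real.log 2 - Real.log (w s).im)] 1 := by
    refine hf.eventuallyEq_one ?_ hlt
    rw [mem_thickPart_iff hρs, hrad, ← hexp, Real.exp_lt_exp] at hth
    exact hth
  have hd : deriv f (Real.log 2 - Real.log (w s).im) = 0 := by
    rw [hone.deriv_eq]
    exact deriv_const _ _
  refine ⟨hlt, hrad.trans hexp.symm, ?_, ?_, ?_, fun h3 h4 => hstat ?_⟩
  · exact ((hasDerivAt_const s (Real.log 2)).sub (h1.log hpos.ne')).congr_deriv (zero_sub _)
  · refine (h2.div h1 hpos.ne').neg.congr_deriv ?_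
    field_simp
    linear_combination -him
  · rw [hd, hone.eq_of_nhds, two_mul, Real.exp_add, hexp]
    simp only [Pi.one_apply]
    field_simp
    ring
  · apply Complex.ext
    · simpa using h4
    · simpa [hpos.ne'] using h3

theorem IsClosedGeodesic.exists_two_le_radius_capped (hf : IsCapProfile ρs f)
    (hρs : ρs < Real.log 2) {γ : ℝ → Sphere3} {T : ℝ}
    (hγ : IsClosedGeodesic (cappedSurface ρs f) γ T) : ∃ t, 2 ≤ radius (γ t) := by
  by_contra! h
  refine not_isClosedGeodesic_of_convexAlong (A := cappedSurface ρs f) (sqCapDist ρs f)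
    (fun t P hP c hc hgeo => ?_) hγ
  rcases hP with (rfl | ⟨i, rfl⟩) | ⟨i, rfl⟩
  · exact convexAlong_sqCapDist_of_thickPatch hf hρs hc hgeo (h t)
  · exact convexAlong_sqCapDist_of_cuspPatch hf hρs hc hgeo
  · exact convexAlong_sqCapDist_of_flatPatch hf hρs hc hgeo

/-! ### Systolic geodesics -/

theorem exists_radius_le_of_not_subset_thickPart (hρs : ρs < Real.log 2) {γ : ℝ → Sphere3}
    (h : ¬ Set.range γ ⊆ thickPart ρs) : ∃ t, radius (γ t) ≤ Real.exp ρs := by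
  obtain ⟨_, ⟨t, rfl⟩, ht⟩ := Set.not_subset.1 h
  exact ⟨t, not_lt.1 fun h' => ht ((mem_thickPart_iff hρs _).2 h')⟩

theorem log_two_sub_le_closedLength_hyp (hρs : ρs < Real.log 2) {γ : ℝ → Sphere3} {T : ℝ}
    (hγ : IsClosedGeodesic hypSurface γ T) (h : ¬ Set.range γ ⊆ thickPart ρs) :
    ENNReal.ofReal (Real.log 2 - ρs) ≤ closedLength hypSurface γ T := by
  refine log_two_sub_le_closedLength hγ hρs ?_ ?_
    (exists_radius_le_of_not_subset_thickPart hρs h) hγ.exists_two_le_radius_hyp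
  · rintro P rfl c t hc
    exact continuousAt_radius_of_hypPatch hc
  · rintro P rfl c t hc - hlt
    exact hasDerivAt_log_radius_of_hypPatch hc hlt

theorem log_two_sub_le_closedLength_capped (hf : IsCapProfile ρs f) (hρs : ρs < Real.log 2)
    {γ : ℝ → Sphere3} {T : ℝ} (hγ : IsClosedGeodesic (cappedSurface ρs f) γ T)
    (h : ¬ Set.range γ ⊆ thickPart ρs) :
    ENNReal.ofReal (Real.log 2 - ρs) ≤ closedLength (cappedSurface ρs f) γ T :=
  log_two_sub_le_closedLength hγ hρs
    (fun _ hP _ _ hc => continuousAt_radius_of_mem_cappedSurface hρs hP hc)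
    (fun _ hP _ _ hc => hasDerivAt_log_radius_of_mem_cappedSurface hf hρs hP hc)
    (exists_radius_le_of_not_subset_thickPart hρs h) (hγ.exists_two_le_radius_capped hf hρs)

/-- A closed geodesic in the thick part counts, with the same length, for both metrics; any other
has length at least `log 2 - ρ_*`, which is above the hyperbolic systole. -/
theorem systole_cappedSurface (hf : IsCapProfile ρs f) (hρs : ρs < Real.log 2)
    (hsys : systole hypSurface < ENNReal.ofReal (Real.log 2 - ρs)) :
    systole (cappedSurface ρs f) = systole hypSurface := by
  refine le_antisymm ?_ ?_
  -- The infimum is not known to be attained, so every hyperbolic closed geodesic is bounded below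
  -- by a minimum strictly above the hyperbolic systole.
  · by_contra! hlt
    refine (lt_min hlt hsys).not_ge (le_iInf₂ fun γ T => le_iInf fun hγ => ?_)
    by_cases h : Set.range γ ⊆ thickPart ρs
    · refine (min_le_left _ _).trans ?_
      rw [← closedLength_cappedSurface hf hρs h]
      exact iInf₂_le_of_le γ T
        (iInf_le_of_le ((isClosedGeodesic_cappedSurface_iff hf hρs h T).2 hγ) le_rfl)
    · exact (min_le_right _ _).trans (log_two_sub_le_closedLength_hyp hρs hγ h)
  · refine le_iInf₂ fun γ T => le_iInf fun hγ => ?_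
    by_cases h : Set.range γ ⊆ thickPart ρs
    · rw [closedLength_cappedSurface hf hρs h]
      exact iInf₂_le_of_le γ T
        (iInf_le_of_le ((isClosedGeodesic_cappedSurface_iff hf hρs h T).1 hγ) le_rfl)
    · exact hsys.le.trans (log_two_sub_le_closedLength_capped hf hρs hγ h)

end Cap

end

theorem theorem4p1 (ρs : ℝ) (f : ℝ → ℝ) (hf : IsCapProfile ρs f)
    (hρs : (ρs : EReal) < (Real.log 2 : EReal) - (systole hypSurface : EReal))
    (γ : ℝ → Sphere3) (T : ℝ) :
    (IsClosedGeodesic (cappedSurface ρs f) γ T ∧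
        closedLength (cappedSurface ρs f) γ T = systole (cappedSurface ρs f)) ↔
      (IsClosedGeodesic hypSurface γ T ∧ closedLength hypSurface γ T = systole hypSurface ∧
        Set.range γ ⊆ thickPart ρs) := by
  -- The hypothesis is read in `EReal`: an infinite systole would make its right side `⊥`.
  -- Finiteness of the systole therefore follows from it.
  have htop : systole hypSurface ≠ ⊤ := fun h => by
    rw [h, EReal.coe_ennreal_top, EReal.sub_top] at hρs
    exact not_lt_bot hρs
  obtain ⟨L, hL⟩ : ∃ L : NNReal, systole hypSurface = L := ⟨_, (ENNReal.coe_toNNReal htop).symm⟩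
  have hlt : ρs < Real.log 2 - L := by
    rw [hL, EReal.coe_nnreal_eq_coe_real, ← EReal.coe_sub, EReal.coe_lt_coe_iff] at hρs
    exact hρs
  have hρs' : ρs < Real.log 2 := hlt.trans_le (sub_le_self _ L.2)
  have hsys : systole hypSurface < ENNReal.ofReal (Real.log 2 - ρs) := by
    rw [hL, ← ENNReal.ofReal_coe_nnreal]
    exact (ENNReal.ofReal_lt_ofReal_iff (by linarith)).2 (by linarith)
  rw [systole_cappedSurface hf hρs' hsys]
  constructor
  · rintro ⟨hγ, hlen⟩
    have h : Set.range γ ⊆ thickPart ρs := by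
      by_contra h
      exact ((log_two_sub_le_closedLength_capped hf hρs' hγ h).trans_eq hlen).not_gt hsys
    exact ⟨(isClosedGeodesic_cappedSurface_iff hf hρs' h T).1 hγ,
      (closedLength_cappedSurface hf hρs' h T).symm.trans hlen, h⟩
  · rintro ⟨hγ, hlen, h⟩
    exact ⟨(isClosedGeodesic_cappedSurface_iff hf hρs' h T).2 hγ,
      (closedLength_cappedSurface hf hρs' h T).trans hlen⟩
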